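/- **Setting.** Let $\mathcal M=(P,\mathbf d)$ be a metric space with $n=|P|<\infty$ points, let $0<\varepsilon\le\frac13$, let $F$ be a field, and let $T$ be a net-tree of $\mathcal M$ with packing constant $K_p>0$. That is, $T$ is a finite rooted tree in which each node $v$ has a representative $\mathrm{rep}(v)\in P$ and a radius $\mathrm{rad}(v)\in\mathbb R$ such that: the leaves represent the points of $P$, each exactly once; every node with children has a child with the same representative; and, with $P_v$ the set of points represented by the leaves below $v$, we have $P_v\subseteq \mathrm{ball}(\mathrm{rep}(v),\mathrm{rad}(v))$ for all $v$ and $\mathrm{ball}(\mathrm{rep}(v),K_p\,\mathrm{rad}(\mathrm{par}(v)))\subseteq P_v$ for every node $v$ other than the root (balls are closed). For $p\in P$ let $v_p$ be the least common ancestor of the nodes represented by $p$. The deletion time is $t_p=\frac{1}{\varepsilon(1-2\varepsilon)}\mathrm{rad}(\mathrm{par}(v_p))$, and $t_p=\infty$ if $v_p$ is the root. For $\alpha\ge 0$ put $w_p(\alpha)=0$ if $\alpha\le(1-2\varepsilon)t_p$, $w_p(\alpha)=\frac12(\alpha-(1-2\varepsilon)t_p)$ if $(1-2\varepsilon)t_p<\alpha<t_p$,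 and $w_p(\alpha)=\varepsilon\alpha$ if $t_p\le\alpha$. Put $\hat{\mathbf d}_\alpha(p,q)=\mathbf d(p,q)+w_p(\alpha)+w_q(\alpha)$. Let $\mathcal Q_\alpha$ (respectively $\overline{\mathcal Q}_\alpha$) be the Vietoris–Rips complex whose simplices are the nonempty sets $\sigma\subseteq\{p: t_p>\alpha\}$ (respectively $\sigma\subseteq\{p:t_p\ge\alpha\}$) with $\hat{\mathbf d}_\alpha(p,q)\le\alpha$ for all $p,q\in\sigma$. Let $A=\{a_1<a_2<\cdots\}$ be a finite or infinite increasing sequence of nonnegative reals that contains every finite $t_p$ and, for every pair $p\ne q$, the edge-insertion scale $\min\{\alpha\ge0:\hat{\mathbf d}_\alpha(p,q)\le\alpha\}$ whenever it exists. Let $\mathcal Q$ be the zigzag filtration $$\overline{\mathcal Q}_{a_1}\hookleftarrow\mathcal Q_{a_1}\hookrightarrow\overline{\mathcal Q}_{a_2}\hookleftarrow\mathcal Q_{a_2}\hookrightarrow\cdots$$ and let $\mathcal S$ be the filtration $\mathcal S_{a_1}\subseteq\mathcal S_{a_2}\subseteq\cdots$ with $\mathcal S_{a_k}=\bigcup_{i\le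 k}\overline{\mathcal Q}_{a_i}$. The degree-$k$ persistence diagram of a (zigzag) filtration is the multiset of points (birth, death) of the intervals in a decomposition of its module $\mathrm H_k(\,\cdot\,;F)$ into interval modules. Birth is the scale of the first complex of the interval; death is the scale of the first complex after the interval, or $\infty$ if there is none; both $\mathcal Q_{a_i}$ and $\overline{\mathcal Q}_{a_i}$ have scale $a_i$. Every diagonal point is added with infinite multiplicity. **Theorem.** For every degree $k\ge0$, each backward inclusion $\mathcal Q_{a_i}\hookrightarrow\overline{\mathcal Q}_{a_i}$ induces an isomorphism on $\mathrm H_k(\,\cdot\,;F)$. The degree-$k$ persistence diagrams of $\mathcal Q$ and of $\mathcal S$ exist, do not depend on the chosen interval decompositions, and are identical. -/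

import Mathlib

noncomputable section

namespace SparseRips

universe u v w

/-! ### Simplicial homology over a field -/

section Homology

variable (F : Type v) [Field F] {P : Type u}

/-- The oriented simplex `[v₀, …, vₙ₋₁]`, as the element `e_{v₀} ∧ ⋯ ∧ e_{vₙ₋₁}` of the exterior
algebra on the free `F`-module with basis `P`.  It changes by the sign of the permutation when the
vertices are permuted and it is zero if a vertex is repeated. -/
def orientedSimplex {n : ℕ} (x : Fin n → P) : ExteriorAlgebra F (P →₀ F) :=
  ExteriorAlgebra.ιMulti F n (fun i => Finsupp.single (x i) (1 : F))

variable (P) in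
/-- The boundary operator: contraction with the linear form that sends every vertex to `1`; see
`boundary_orientedSimplex` for the usual alternating sum. -/
def boundary : ExteriorAlgebra F (P →₀ F) →ₗ[F] ExteriorAlgebra F (P →₀ F) :=
  CliffordAlgebra.contractLeft (Finsupp.linearCombination F (fun _ : P => (1 : F)))

/-- `∂ [v₀, …, vₙ] = ∑ᵢ (-1)ⁱ [v₀, …, v̂ᵢ, …, vₙ]`. -/
theorem boundary_orientedSimplex {n : ℕ} (x : Fin (n + 1) → P) :
    boundary F P (orientedSimplex F x) =
      ∑ i : Fin (n + 1), (-1 : F) ^ (i : ℕ) • orientedSimplex F (fun j => x (i.succAbove j)) := by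
  have key : ∀ (m : ℕ) (y : Fin (m + 1) → P), boundary F P (orientedSimplex F y) =
      orientedSimplex F (fun j => y j.succ) -
        ExteriorAlgebra.ι F (Finsupp.single (y 0) (1 : F)) *
          boundary F P (orientedSimplex F (fun j => y j.succ)) := by
    intro m y
    have h : orientedSimplex F y = ExteriorAlgebra.ι F (Finsupp.single (y 0) (1 : F)) *
        orientedSimplex F (fun j => y j.succ) := by
      simp [orientedSimplex, ExteriorAlgebra.ιMulti_succ_apply, Matrix.vecTail, Function.comp_def]
    rw [h, boundary]
    erw [CliffordAlgebra.contractLeft_ι_mul]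
    simp
  induction n with
  | zero =>
    rw [key]
    simp [boundary, orientedSimplex]
  | succ n ih =>
    rw [key, ih, Finset.mul_sum, sub_eq_add_neg, ← Finset.sum_neg_distrib,
      Fin.sum_univ_succ (n := n + 1)]
    congr 1
    · simp
    · refine Finset.sum_congr rfl fun i _ => ?_
      have h : orientedSimplex F (fun j => x (i.succ.succAbove j)) =
          ExteriorAlgebra.ι F (Finsupp.single (x 0) (1 : F)) *
            orientedSimplex F (fun j => x (i.succAbove j).succ) := by
        simp [orientedSimplex, ExteriorAlgebra.ιMulti_succ_apply, Matrix.vecTail,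
          Function.comp_def]
      rw [h, Fin.val_succ, pow_succ, mul_smul_comm]
      simp

/-- The `k`-chains of `K`: the span of the oriented simplices on `k + 1` vertices of `K`. -/
def chains (K : PreAbstractSimplicialComplex P) (k : ℕ) :
    Submodule F (ExteriorAlgebra F (P →₀ F)) :=
  Submodule.span F {c | ∃ x : Fin (k + 1) → P,
    (∃ σ ∈ K, (σ : Set P) = Set.range x) ∧ c = orientedSimplex F x}

/-- The `k`-cycles of `K` (every `0`-chain is a `0`-cycle: the homology is not reduced). -/
def cycles (K : PreAbstractSimplicialComplex P) : ℕ → Submodule F (ExteriorAlgebra F (P →₀ F))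
  | 0 => chains F K 0
  | k + 1 => chains F K (k + 1) ⊓ LinearMap.ker (boundary F P)

/-- The `k`-boundaries of `K`. -/
def boundaries (K : PreAbstractSimplicialComplex P) (k : ℕ) :
    Submodule F (ExteriorAlgebra F (P →₀ F)) :=
  (chains F K (k + 1)).map (boundary F P)

theorem boundaries_le_cycles (K : PreAbstractSimplicialComplex P) (k : ℕ) :
    boundaries F K k ≤ cycles F K k := by
  have h1 : boundaries F K k ≤ chains F K k := by
    rw [boundaries, chains, Submodule.map_span_le]
    rintro _ ⟨x, ⟨σ, hσ, hx⟩, rfl⟩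
    rw [boundary_orientedSimplex]
    refine Submodule.sum_mem _ fun i _ => Submodule.smul_mem _ _ (Submodule.subset_span ?_)
    classical
    refine ⟨_, ⟨Finset.univ.image fun j => x (i.succAbove j), ?_, by simp⟩, rfl⟩
    refine (K.isRelLowerSet_faces hσ).2 ?_ ?_
    · intro p hp
      have : p ∈ (σ : Set P) := by
        rw [hx]
        obtain ⟨j, -, rfl⟩ := Finset.mem_image.1 hp
        exact ⟨_, rfl⟩
      exact this
    · exact Finset.Nonempty.image Finset.univ_nonempty _
  cases k with
  | zero => exact h1
  | succ k =>
    refine le_inf h1 ?_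
    rintro _ ⟨c, -, rfl⟩
    exact CliffordAlgebra.contractLeft_contractLeft (d := _) c

theorem chains_mono {K L : PreAbstractSimplicialComplex P} (h : K ≤ L) (k : ℕ) :
    chains F K k ≤ chains F L k := by
  refine Submodule.span_mono ?_
  rintro _ ⟨x, ⟨σ, hσ, hx⟩, rfl⟩
  exact ⟨x, ⟨σ, h hσ, hx⟩, rfl⟩

theorem cycles_mono {K L : PreAbstractSimplicialComplex P} (h : K ≤ L) (k : ℕ) :
    cycles F K k ≤ cycles F L k := by
  cases k with
  | zero => exact chains_mono F h 0
  | succ k => exact inf_le_inf_right _ (chains_mono F h (k + 1))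

/-- The simplicial homology `H_k(K; F)`: cycles modulo boundaries. -/
abbrev Homology (K : PreAbstractSimplicialComplex P) (k : ℕ) : Type (max u v) :=
  (cycles F K k) ⧸ (boundaries F K k).submoduleOf (cycles F K k)

/-- The map `H_k(K; F) → H_k(L; F)` induced by an inclusion `K ⊆ L`. -/
def homologyMap {K L : PreAbstractSimplicialComplex P} (h : K ≤ L) (k : ℕ) :
    Homology F K k →ₗ[F] Homology F L k :=
  Submodule.mapQ _ _ (Submodule.inclusion (cycles_mono F h k))
    (fun _ hc => Submodule.map_mono (chains_mono F h (k + 1)) hc)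

end Homology

/-! ### Zigzag modules, zigzag filtrations and their persistence diagrams -/

/-- A zigzag module over a linearly ordered index set: a vector space for each index and, for any
two neighbouring indices, a linear map in one of the two directions.  A persistence module is the
case in which all the arrows go forward. -/
structure ZigzagModule (F : Type v) [Field F] (ι : Type u) [LinearOrder ι] where
  space : ι → Type w
  [addCommGroup : ∀ i, AddCommGroup (space i)]
  [module : ∀ i, Module F (space i)]
  /-- `arrow i j`: there is an arrow from `i` to `j`. -/
  arrow : ι → ι → Prop
  adjacent : ∀ {i j}, arrow i j → i ⋖ j ∨ j ⋖ i
  xor_arrow : ∀ {i j}, i ⋖ j → Xor (arrow i j) (arrow j i)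
  map : ∀ {i j}, arrow i j → space i →ₗ[F] space j

attribute [instance] ZigzagModule.addCommGroup ZigzagModule.module

/-- A zigzag filtration: a family of simplicial complexes on vertices in `P`, any two neighbouring
ones being related by an inclusion in one of the two directions. -/
structure ZigzagFiltration (P : Type v) (ι : Type u) [LinearOrder ι] where
  complex : ι → PreAbstractSimplicialComplex P
  /-- `arrow i j`: the inclusion of the complex at `i` into the complex at `j` is an arrow. -/
  arrow : ι → ι → Prop
  adjacent : ∀ {i j}, arrow i j → i ⋖ j ∨ j ⋖ i
  xor_arrow : ∀ {i j}, i ⋖ j → Xor (arrow i j) (arrow j i)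
  le : ∀ {i j}, arrow i j → complex i ≤ complex j

/-- A (non-zigzag) filtration: all the arrows go forward. -/
def ZigzagFiltration.ofMonotone {P : Type v} {ι : Type u} [LinearOrder ι]
    (K : ι → PreAbstractSimplicialComplex P) (hK : Monotone K) : ZigzagFiltration P ι where
  complex := K
  arrow i j := i ⋖ j
  adjacent h := Or.inl h
  xor_arrow h := Or.inl ⟨h, fun h' => lt_asymm h.lt h'.lt⟩
  le h := hK h.le

/-- The zigzag module of the `k`-th homology of a zigzag filtration. -/
def ZigzagFiltration.homology {P : Type v} {ι : Type u} [LinearOrder ι]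
    (K : ZigzagFiltration P ι) (F : Type w) [Field F] (k : ℕ) :
    ZigzagModule.{u, w, max v w} F ι where
  space i := Homology F (K.complex i) k
  arrow := K.arrow
  adjacent := K.adjacent
  xor_arrow := K.xor_arrow
  map h := homologyMap F (K.le h) k

/-- A decomposition of a zigzag module as a direct sum of interval modules, indexed by `B`: each
`β : B` has an interval `bar β` of indices, the `β` with `i ∈ bar β` index a basis of the space at
`i`, and every arrow sends the basis vector of `β` to the basis vector of `β`, or to `0` if the
target is not in `bar β`. -/
structure IntervalDecomposition {F : Type v} [Field F] {ι : Type u} [LinearOrder ι]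
    (M : ZigzagModule.{u, v, w} F ι) (B : Type) where
  bar : B → Set ι
  bar_nonempty : ∀ β, (bar β).Nonempty
  bar_ordConnected : ∀ β, (bar β).OrdConnected
  basis : ∀ i, Module.Basis {β : B // i ∈ bar β} F (M.space i)
  map_of_mem : ∀ {i j} (h : M.arrow i j) (β : B) (hi : i ∈ bar β) (hj : j ∈ bar β),
    M.map h (basis i ⟨β, hi⟩) = basis j ⟨β, hj⟩
  map_of_notMem : ∀ {i j} (h : M.arrow i j) (β : B) (hi : i ∈ bar β), j ∉ bar β →
    M.map h (basis i ⟨β, hi⟩) = 0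

/-- `x` is the birth time of the interval `I`: the scale of the first index in `I`. -/
def IsBirth {ι : Type u} [LinearOrder ι] (scale : ι → ℝ) (I : Set ι) (x : WithTop ℝ) : Prop :=
  ∃ i, IsLeast I i ∧ x = (scale i : WithTop ℝ)

/-- `y` is the death time of the interval `I`: the scale of the first index after `I`, where `I`
has disappeared, or `∞` if there is no index after `I`. -/
def IsDeath {ι : Type u} [LinearOrder ι] (scale : ι → ℝ) (I : Set ι) (y : WithTop ℝ) : Prop :=
  (∃ j, IsLeast {j | ∀ i ∈ I, i < j} j ∧ y = (scale j : WithTop ℝ)) ∨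
    ((¬ ∃ j, ∀ i ∈ I, i < j) ∧ y = ⊤)

open Classical in
/-- The multiset of points `(birth, death)` of a decomposition, given by the multiplicity of each
point of `(ℝ ∪ {∞})²`.  Every point of the diagonal has infinite multiplicity. -/
def IntervalDecomposition.diagram {F : Type v} [Field F] {ι : Type u} [LinearOrder ι]
    {M : ZigzagModule.{u, v, w} F ι} {B : Type} (I : IntervalDecomposition M B) (scale : ι → ℝ) :
    WithTop ℝ × WithTop ℝ → ℕ∞ := fun z =>
  if z.1 = z.2 then ⊤
  else ENat.card {β : B // IsBirth scale (I.bar β) z.1 ∧ IsDeath scale (I.bar β) z.2}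

/-- `D` is a persistence diagram of the zigzag module `M`, whose index `i` has scale `scale i`. -/
def IsPersistenceDiagram {F : Type v} [Field F] {ι : Type u} [LinearOrder ι]
    (M : ZigzagModule.{u, v, w} F ι) (scale : ι → ℝ) (D : WithTop ℝ × WithTop ℝ → ℕ∞) : Prop :=
  ∃ (B : Type) (I : IntervalDecomposition M B), D = I.diagram scale

/-! ### Relaxed distance and sparse complexes for given deletion times -/

section Sparse

variable {P : Type u}

/-- The weight at scale `α` of a point with deletion time `t`; for `t = ∞` it is `0`. -/
def weight (ε : ℝ) : WithTop ℝ → ℝ → ℝ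
  | ⊤, _ => 0
  | (t : ℝ), α =>
    if α ≤ (1 - 2 * ε) * t then 0
    else if α < t then (α - (1 - 2 * ε) * t) / 2
    else ε * α

/-- The Vietoris–Rips complex `VR(X, d, α)`. -/
def vietorisRips (X : Set P) (d : P → P → ℝ) (α : ℝ) : PreAbstractSimplicialComplex P where
  faces := {σ | σ.Nonempty ∧ (σ : Set P) ⊆ X ∧ ∀ p ∈ σ, ∀ q ∈ σ, d p q ≤ α}
  isRelLowerSet_faces := by
    rintro σ ⟨hne, hX, hd⟩
    exact ⟨hne, fun τ hτ hτne => ⟨hτne, fun p hp => hX (hτ hp),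
      fun p hp q hq => hd p (hτ hp) q (hτ hq)⟩⟩

/-- The open net: the points with deletion time greater than `α`. -/
def openNet (t : P → WithTop ℝ) (α : ℝ) : Set P := {p | (α : WithTop ℝ) < t p}

/-- The closed net: the points with deletion time at least `α`. -/
def closedNet (t : P → WithTop ℝ) (α : ℝ) : Set P := {p | (α : WithTop ℝ) ≤ t p}

variable [MetricSpace P]

/-- The relaxed distance at scale `α`. -/
def relaxedDist (ε : ℝ) (t : P → WithTop ℝ) (α : ℝ) (p q : P) : ℝ :=
  dist p q + weight ε (t p) α + weight ε (t q) α

/-- The sparse zigzag Vietoris–Rips complex `Q_α`. -/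
def openComplex (ε : ℝ) (t : P → WithTop ℝ) (α : ℝ) : PreAbstractSimplicialComplex P :=
  vietorisRips (openNet t α) (relaxedDist ε t α) α

/-- The closed sparse zigzag Vietoris–Rips complex `cl Q_α`. -/
def closedComplex (ε : ℝ) (t : P → WithTop ℝ) (α : ℝ) : PreAbstractSimplicialComplex P :=
  vietorisRips (closedNet t α) (relaxedDist ε t α) α

/-- `A = {a₁ < a₂ < ⋯}` is a finite or infinite increasing sequence of nonnegative scales that
contains every finite deletion time and, for every pair of points, the scale at which the edge
between them is inserted. -/
structure IsScaleSet (ε : ℝ) (t : P → WithTop ℝ) (A : Set ℝ) : Prop where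
  nonneg : ∀ a ∈ A, 0 ≤ a
  finite_below : ∀ a ∈ A, (A ∩ Set.Iic a).Finite
  deletion_mem : ∀ (p : P) (α : ℝ), t p = α → α ∈ A
  insertion_mem : ∀ (p q : P) (α : ℝ), p ≠ q →
    IsLeast {β : ℝ | 0 ≤ β ∧ relaxedDist ε t β p q ≤ β} α → α ∈ A

theorem weight_le_weight_add {ε : ℝ} (h0 : 0 < ε) (h1 : ε ≤ 1 / 3) (t : WithTop ℝ) {α β : ℝ}
    (hα : 0 ≤ α) (h : α ≤ β) : weight ε t β ≤ weight ε t α + (β - α) / 2 := by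
  induction t using WithTop.recTopCoe with
  | top => simp only [weight]; linarith
  | coe t =>
    simp only [weight]
    split_ifs <;> nlinarith

theorem vietorisRips_mono {ε : ℝ} (h0 : 0 < ε) (h1 : ε ≤ 1 / 3) (t : P → WithTop ℝ) {α β : ℝ}
    (hα : 0 ≤ α) (h : α ≤ β) {X Y : Set P} (hXY : X ⊆ Y) :
    vietorisRips X (relaxedDist ε t α) α ≤ vietorisRips Y (relaxedDist ε t β) β := by
  rintro σ ⟨hne, hX, hd⟩
  refine ⟨hne, hX.trans hXY, fun p hp q hq => ?_⟩
  have h2 := hd p hp q hq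
  have hp' := weight_le_weight_add h0 h1 (t p) hα h
  have hq' := weight_le_weight_add h0 h1 (t q) hα h
  simp only [relaxedDist] at h2 ⊢
  linarith

theorem openComplex_le_closedComplex {ε : ℝ} (h0 : 0 < ε) (h1 : ε ≤ 1 / 3) (t : P → WithTop ℝ)
    {α : ℝ} (hα : 0 ≤ α) : openComplex ε t α ≤ closedComplex ε t α :=
  vietorisRips_mono h0 h1 t hα le_rfl fun p hp => show (α : WithTop ℝ) ≤ t p from le_of_lt hp

theorem openComplex_le_closedComplex_next {ε : ℝ} (h0 : 0 < ε) (h1 : ε ≤ 1 / 3)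
    {t : P → WithTop ℝ} {A : Set ℝ} (hA : IsScaleSet ε t A) {a b : A} (hab : a ⋖ b) :
    openComplex ε t a ≤ closedComplex ε t b := by
  refine vietorisRips_mono h0 h1 t (hA.nonneg a a.2) hab.le fun p hp => ?_
  simp only [openNet, closedNet, Set.mem_ofPred_eq] at hp ⊢
  by_contra hlt
  rw [not_le] at hlt
  obtain ⟨r, hr⟩ := WithTop.ne_top_iff_exists.1 hlt.ne_top
  rw [← hr, WithTop.coe_lt_coe] at hp hlt
  exact hab.2 (c := ⟨r, hA.deletion_mem p r hr.symm⟩) hp hlt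

/-! ### The zigzag filtration `Q` and the filtration `S` -/

/-- The complexes of `Q` in the order `cl Q_{a₁}, Q_{a₁}, cl Q_{a₂}, Q_{a₂}, …`: the position
`(a, false)` holds `cl Q_a` and the position `(a, true)` holds `Q_a`. -/
def zigzagComplex (ε : ℝ) (t : P → WithTop ℝ) (A : Set ℝ) (i : A ×ₗ Bool) :
    PreAbstractSimplicialComplex P :=
  if (ofLex i).2 then openComplex ε t (ofLex i).1 else closedComplex ε t (ofLex i).1

/-- The arrows of `Q`: `Q_a → cl Q_a` (backward) and `Q_a → cl Q_b` (forward) where `b` is the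
scale that follows `a` in `A`. -/
def zigzagArrow (A : Set ℝ) (i j : A ×ₗ Bool) : Prop :=
  (ofLex i).2 = true ∧ (ofLex j).2 = false ∧
    ((ofLex j).1 = (ofLex i).1 ∨ (ofLex i).1 ⋖ (ofLex j).1)

theorem covBy_iff_lex {A : Set ℝ} (i j : A ×ₗ Bool) : i ⋖ j ↔
    ((ofLex i).1 = (ofLex j).1 ∧ (ofLex i).2 = false ∧ (ofLex j).2 = true) ∨
      ((ofLex i).1 ⋖ (ofLex j).1 ∧ (ofLex i).2 = true ∧ (ofLex j).2 = false) := by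
  obtain ⟨⟨a, c⟩, rfl⟩ := toLex.surjective i
  obtain ⟨⟨b, d⟩, rfl⟩ := toLex.surjective j
  simp only [ofLex_toLex]
  constructor
  · rintro ⟨hlt, hno⟩
    rw [Prod.Lex.toLex_lt_toLex] at hlt
    rcases hlt with hab | ⟨hab, hcd⟩
    · right
      have hc : c = true := by
        by_contra hc
        refine hno (c := toLex (a, true)) ?_ ?_ <;> rw [Prod.Lex.toLex_lt_toLex]
        · exact Or.inr ⟨rfl, by simpa [Bool.lt_iff] using hc⟩
        · exact Or.inl hab
      have hd : d = false := by
        by_contra hd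
        refine hno (c := toLex (b, false)) ?_ ?_ <;> rw [Prod.Lex.toLex_lt_toLex]
        · exact Or.inl hab
        · exact Or.inr ⟨rfl, by simpa [Bool.lt_iff] using hd⟩
      refine ⟨⟨hab, fun x hax hxb => hno (c := toLex (x, c)) ?_ ?_⟩, hc, hd⟩ <;>
        rw [Prod.Lex.toLex_lt_toLex]
      · exact Or.inl hax
      · exact Or.inl hxb
    · left
      exact ⟨hab, (Bool.lt_iff.1 hcd).1, (Bool.lt_iff.1 hcd).2⟩
  · rintro (⟨rfl, rfl, rfl⟩ | ⟨hab, rfl, rfl⟩)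
    · refine ⟨by rw [Prod.Lex.toLex_lt_toLex]; exact Or.inr ⟨rfl, Bool.false_lt_true⟩, fun x h h' => ?_⟩
      obtain ⟨⟨x, e⟩, rfl⟩ := toLex.surjective x
      rw [Prod.Lex.toLex_lt_toLex] at h h'
      rcases h with h | ⟨h, he⟩ <;> rcases h' with h' | ⟨h', he'⟩
      · exact lt_asymm h h'
      · exact h.ne h'.symm
      · exact h'.ne h.symm
      · rw [Bool.lt_iff] at he he'
        simp_all
    · refine ⟨by rw [Prod.Lex.toLex_lt_toLex]; exact Or.inl hab.lt, fun x h h' => ?_⟩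
      obtain ⟨⟨x, e⟩, rfl⟩ := toLex.surjective x
      rw [Prod.Lex.toLex_lt_toLex] at h h'
      rcases h with h | ⟨h, he⟩ <;> rcases h' with h' | ⟨h', he'⟩
      · exact hab.2 h h'
      · simp [Bool.lt_iff] at he'
      · simp [Bool.lt_iff] at he
      · simp [Bool.lt_iff] at he

/-- The sparse zigzag Vietoris–Rips filtration
`cl Q_{a₁} ⊇ Q_{a₁} ⊆ cl Q_{a₂} ⊇ Q_{a₂} ⊆ ⋯`. -/
def zigzagRips {ε : ℝ} (h0 : 0 < ε) (h1 : ε ≤ 1 / 3) {t : P → WithTop ℝ} {A : Set ℝ}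
    (hA : IsScaleSet ε t A) : ZigzagFiltration P (A ×ₗ Bool) where
  complex := zigzagComplex ε t A
  arrow := zigzagArrow A
  adjacent := by
    rintro i j ⟨hi, hj, h | h⟩
    · exact Or.inr ((covBy_iff_lex j i).2 (Or.inl ⟨h, hj, hi⟩))
    · exact Or.inl ((covBy_iff_lex i j).2 (Or.inr ⟨h, hi, hj⟩))
  xor_arrow := by
    intro i j h
    rcases (covBy_iff_lex i j).1 h with ⟨h, hi, hj⟩ | ⟨h, hi, hj⟩
    · exact Or.inr ⟨⟨hj, hi, Or.inl h⟩, fun h' => by simp [h'.1] at hi⟩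
    · exact Or.inl ⟨⟨hi, hj, Or.inr h⟩, fun h' => by simp [h'.1] at hj⟩
  le := by
    rintro i j ⟨hi, hj, h | h⟩
    · simp only [zigzagComplex, hi, hj, h]
      exact openComplex_le_closedComplex h0 h1 t (hA.nonneg _ (ofLex i).1.2)
    · simp only [zigzagComplex, hi, hj]
      exact openComplex_le_closedComplex_next h0 h1 hA h

/-- The union `S_a` of the closed complexes `cl Q_b` over the scales `b ≤ a` of `A`. -/
def unionComplex (ε : ℝ) (t : P → WithTop ℝ) (A : Set ℝ) (a : A) :
    PreAbstractSimplicialComplex P :=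
  ⨆ b : A, ⨆ _ : b ≤ a, closedComplex ε t b

/-- The sparse Vietoris–Rips filtration `S = {S_a}`, `a ∈ A`. -/
def sparseRips (ε : ℝ) (t : P → WithTop ℝ) (A : Set ℝ) : ZigzagFiltration P A :=
  ZigzagFiltration.ofMonotone (unionComplex ε t A) fun _ _ hab =>
    iSup_mono fun _ => iSup_mono' fun h => ⟨h.trans hab, le_rfl⟩

end Sparse

/-! ### Net-trees -/

/-- The children of a node `x`: the nodes other than the root whose parent is `x`. -/
def children (T : RootedTree.{w}) (x : T) : Set T := {y | y ≠ ⊥ ∧ Order.pred y = x}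

/-- The points represented by the leaves of the subtree rooted at `x`; here `x ≤ l` means that `x`
is an ancestor of `l` or `l` itself. -/
def leafPoints {P : Type u} (T : RootedTree.{w}) (rep : T → P) (x : T) : Set P :=
  rep '' {l | children T l = ∅ ∧ x ≤ l}

/-- A net-tree with packing constant `Kp` of the metric space `P`.  The root of `tree` is `⊥` and
the parent of a node `x ≠ ⊥` is `Order.pred x`. -/
structure NetTree (P : Type u) [MetricSpace P] (Kp : ℝ) where
  tree : RootedTree.{w}
  finite : Finite tree
  rep : tree → P
  rad : tree → ℝ
  /-- The leaves represent the points of `P`, each exactly once. -/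
  leaves : Set.BijOn rep {l | children tree l = ∅} Set.univ
  rep_child : ∀ x, (children tree x).Nonempty → ∃ y ∈ children tree x, rep y = rep x
  covering : ∀ x, leafPoints tree rep x ⊆ Metric.closedBall (rep x) (rad x)
  packing : ∀ x, x ≠ ⊥ →
    Metric.closedBall (rep x) (Kp * rad (Order.pred x)) ⊆ leafPoints tree rep x

namespace NetTree

variable {P : Type u} [MetricSpace P] {Kp : ℝ} (T : NetTree.{u, w} P Kp)

theorem exists_rep (p : P) : {x | T.rep x = p}.Nonempty := by
  obtain ⟨l, -, hl⟩ := T.leaves.surjOn (Set.mem_univ p)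
  exact ⟨l, hl⟩

/-- The least common ancestor `v_p` of the nodes represented by `p`. -/
def topNode (p : P) : T.tree :=
  haveI := T.finite
  (Set.toFinite {x | T.rep x = p}).toFinset.inf'
    ((Set.Finite.toFinset_nonempty _).2 (T.exists_rep p)) id

open Classical in
/-- The deletion time `t_p = rad(par(v_p)) / (ε (1 - 2 ε))`; it is `∞` if `v_p` is the root, which
has no parent. -/
def deletionTime (ε : ℝ) (p : P) : WithTop ℝ :=
  if T.topNode p = ⊥ then ⊤
  else ((1 / (ε * (1 - 2 * ε)) * T.rad (Order.pred (T.topNode p)) : ℝ) : WithTop ℝ)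

end NetTree

end SparseRips

end

/-! Everything is compared with the union `S_a`. The weights grow with slope at most 1/2, so an edge
present at one scale satisfies the Rips condition at every later scale. Hence `cl Q_a` and `Q_a` are
the full subcomplexes of `S_a` on the closed and the open net at `a`, and each arises from `S_a` by
removing points deleted no later than `a`.

Such a removal preserves homology. At the time `t_p` some `q` lies within `ε t_p` of `p`, is deleted
later and still has weight 0, while `p` has weight `ε t_p`. The triangle inequality then makes `q`
adjacent to every neighbour of `p` (`exists_dominating`): among the points deleted no earlier, `p`
is dominated by `q`. An explicit chain homotopy shows that removing a dominated vertex is an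
isomorphism on homology (`bijective_homologyMap_of_dominated`), and points are removed one at a
time, the earliest deleted first (`bijective_homologyMap_restrictTo`).

So every complex of the zigzag includes into its `S_a` with an isomorphism on homology, and the
squares of inclusions commute. The zigzag module is the module of `S` with each space doubled
(`isDoubling_zigzagRips`), and interval decompositions pass in both directions with the same birth
and death scales. For `S` itself, decompositions exist by choosing generators adapted to the kernels
of the transition maps (`exists_intervalDecomposition`), and their diagrams agree because ranks of
transition maps determine the multiplicities (`diagram_eq`). -/

noncomputable section

namespace SparseRips

universe u v w w'

/-! ### Removal of a dominated vertex, in the exterior algebra. -/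

section DominatedVertex

variable (F : Type v) [Field F] {P : Type u}

/-- The element of the exterior algebra given by a vertex. -/
def vertexElt (p : P) : ExteriorAlgebra F (P →₀ F) :=
  ExteriorAlgebra.ι F (Finsupp.single p (1 : F))

/-- Contraction with the coordinate form of the vertex `p`. -/
def vertexContract (p : P) : ExteriorAlgebra F (P →₀ F) →ₗ[F] ExteriorAlgebra F (P →₀ F) :=
  CliffordAlgebra.contractLeft (Finsupp.lapply p)

theorem orientedSimplex_succ {n : ℕ} (x : Fin (n + 1) → P) :
    orientedSimplex F x = vertexElt F (x 0) * orientedSimplex F (fun j => x j.succ) := by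
  simp [orientedSimplex, vertexElt, ExteriorAlgebra.ιMulti_succ_apply, Matrix.vecTail,
    Function.comp_def]

theorem orientedSimplex_cons {n : ℕ} (p : P) (x : Fin n → P) :
    orientedSimplex F (Fin.cons p x : Fin (n + 1) → P) = vertexElt F p * orientedSimplex F x := by
  rw [orientedSimplex_succ]
  simp

theorem vertexContract_vertexElt_mul (p q : P) (c : ExteriorAlgebra F (P →₀ F)) :
    vertexContract F p (vertexElt F q * c) =
      (Finsupp.single q (1 : F) p) • c - vertexElt F q * vertexContract F p c := by
  rw [vertexContract, vertexElt]
  erw [CliffordAlgebra.contractLeft_ι_mul]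
  rfl

theorem boundary_vertexElt_mul (q : P) (c : ExteriorAlgebra F (P →₀ F)) :
    boundary F P (vertexElt F q * c) = c - vertexElt F q * boundary F P c := by
  rw [boundary, vertexElt]
  erw [CliffordAlgebra.contractLeft_ι_mul]
  simp

theorem boundary_vertexContract (p : P) (c : ExteriorAlgebra F (P →₀ F)) :
    boundary F P (vertexContract F p c) = - vertexContract F p (boundary F P c) :=
  CliffordAlgebra.contractLeft_comm _ _ _

theorem boundary_boundary (c : ExteriorAlgebra F (P →₀ F)) :
    boundary F P (boundary F P c) = 0 :=
  CliffordAlgebra.contractLeft_contractLeft (d := _) c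

theorem vertexContract_orientedSimplex_zero (p : P) (x : Fin 0 → P) :
    vertexContract F p (orientedSimplex F x) = 0 := by
  simp [vertexContract, orientedSimplex]

theorem vertexContract_orientedSimplex (p : P) {n : ℕ} (x : Fin (n + 1) → P) :
    vertexContract F p (orientedSimplex F x) =
      ∑ i : Fin (n + 1), ((-1 : F) ^ (i : ℕ) * Finsupp.single (x i) (1 : F) p) •
        orientedSimplex F (fun j => x (i.succAbove j)) := by
  induction n with
  | zero =>
    rw [orientedSimplex_succ, vertexContract_vertexElt_mul, vertexContract_orientedSimplex_zero]
    simp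
  | succ n ih =>
    rw [orientedSimplex_succ, vertexContract_vertexElt_mul, ih, Finset.mul_sum, sub_eq_add_neg,
      ← Finset.sum_neg_distrib, Fin.sum_univ_succ (n := n + 1)]
    congr 1
    · simp
    · refine Finset.sum_congr rfl fun i _ => ?_
      have h : orientedSimplex F (fun j => x (i.succ.succAbove j)) =
          vertexElt F (x 0) * orientedSimplex F (fun j => x (i.succAbove j).succ) := by
        rw [orientedSimplex_succ]
        simp
      rw [h, Fin.val_succ, pow_succ, mul_smul_comm, ← neg_smul]
      congr 1
      ring

/-- The chain homotopy that moves the vertex `p` to the vertex `q`. -/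
def moveHomotopy (p q : P) : ExteriorAlgebra F (P →₀ F) →ₗ[F] ExteriorAlgebra F (P →₀ F) :=
  LinearMap.mulLeft F (vertexElt F q * vertexElt F p) ∘ₗ vertexContract F p

theorem moveHomotopy_apply (p q : P) (c : ExteriorAlgebra F (P →₀ F)) :
    moveHomotopy F p q c = vertexElt F q * (vertexElt F p * vertexContract F p c) := by
  simp [moveHomotopy]

/-- The chain map that moves the vertex `p` to the vertex `q`. -/
def moveVertex (p q : P) (c : ExteriorAlgebra F (P →₀ F)) : ExteriorAlgebra F (P →₀ F) :=
  c - (vertexElt F p - vertexElt F q) * vertexContract F p c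

/-- Contraction with `p` anticommutes with the boundary, so the two terms containing the contraction
of `∂c` cancel and only `(p - q) ∧` the contraction of `c` remains. -/
theorem boundary_moveHomotopy (p q : P) (c : ExteriorAlgebra F (P →₀ F)) :
    boundary F P (moveHomotopy F p q c) + moveHomotopy F p q (boundary F P c) =
      c - moveVertex F p q c := by
  simp only [moveHomotopy_apply, moveVertex, boundary_vertexElt_mul, boundary_vertexContract]
  noncomm_ring

/-- The map is the identity minus `∂h + h∂`, which commutes with `∂` because `∂∂ = 0`. -/
theorem boundary_moveVertex (p q : P) (c : ExteriorAlgebra F (P →₀ F)) :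
    boundary F P (moveVertex F p q c) = moveVertex F p q (boundary F P c) := by
  have h1 := congrArg (boundary F P) (boundary_moveHomotopy F p q c)
  have h2 := boundary_moveHomotopy F p q (boundary F P c)
  rw [map_add, map_sub, boundary_boundary, zero_add] at h1
  rw [boundary_boundary, map_zero, add_zero, h1] at h2
  exact sub_right_injective h2

theorem vertexElt_mul_self (p : P) : vertexElt F p * vertexElt F p = 0 :=
  ExteriorAlgebra.ι_sq_zero _

theorem vertexElt_mul_swap (p q : P) :
    vertexElt F p * vertexElt F q = - (vertexElt F q * vertexElt F p) :=
  eq_neg_of_add_eq_zero_left (ExteriorAlgebra.ι_add_mul_swap _ _)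

/-- One factor at a time, this identifies `moveVertex` with the algebra map induced by `p ↦ q`; its
effect on oriented simplices follows. -/
theorem moveVertex_vertexElt_mul [DecidableEq P] (p q r : P) (c : ExteriorAlgebra F (P →₀ F)) :
    moveVertex F p q (vertexElt F r * c) =
      vertexElt F (if r = p then q else r) * moveVertex F p q c := by
  simp only [moveVertex, vertexContract_vertexElt_mul, Finsupp.single_apply]
  generalize vertexContract F p c = d
  have hpp := fun z => congrArg (· * z) (vertexElt_mul_self F p)
  have hqq := fun z => congrArg (· * z) (vertexElt_mul_self F q)
  split_ifs with h
  · subst h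
    have h1 := congrArg (· * d) (vertexElt_mul_swap F q r)
    simp only [mul_assoc, neg_mul] at h1
    simp only [mul_assoc, zero_mul] at hpp hqq
    simp only [one_smul, mul_sub, sub_mul, hpp, hqq, h1]
    abel
  · have h1 := congrArg (· * d) (vertexElt_mul_swap F r p)
    have h2 := congrArg (· * d) (vertexElt_mul_swap F r q)
    simp only [mul_assoc, neg_mul] at h1 h2
    simp only [zero_smul, mul_sub, sub_mul, h1, h2]
    noncomm_ring

theorem moveVertex_orientedSimplex [DecidableEq P] (p q : P) {n : ℕ} (x : Fin n → P) :
    moveVertex F p q (orientedSimplex F x) =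
      orientedSimplex F (fun i => if x i = p then q else x i) := by
  induction n with
  | zero =>
    rw [moveVertex, vertexContract_orientedSimplex_zero, mul_zero, sub_zero]
    congr 1
    exact Subsingleton.elim _ _
  | succ n ih => rw [orientedSimplex_succ, moveVertex_vertexElt_mul, ih, orientedSimplex_succ]

variable {F}

theorem orientedSimplex_mem_chains {K : PreAbstractSimplicialComplex P} {k : ℕ}
    {x : Fin (k + 1) → P} {σ : Finset P} (hσ : σ ∈ K) (hx : Set.range x ⊆ σ) :
    orientedSimplex F x ∈ chains F K k := by
  classical
  refine Submodule.subset_span ⟨x, ⟨Finset.univ.image x, ?_, by simp⟩, rfl⟩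
  refine (K.isRelLowerSet_faces hσ).2 ?_ (Finset.univ_nonempty.image _)
  intro p hp
  obtain ⟨i, -, rfl⟩ := Finset.mem_image.1 hp
  exact hx ⟨i, rfl⟩

theorem cycles_le_chains (K : PreAbstractSimplicialComplex P) (k : ℕ) :
    cycles F K k ≤ chains F K k := by
  cases k with
  | zero => exact le_rfl
  | succ k => exact inf_le_left

/-- In degree 0 the homology is not reduced, and the boundary of a cycle may be a nonzero scalar.
Contraction kills scalars, so the homotopy argument needs no special case. -/
theorem vertexContract_boundary_of_mem_cycles {K : PreAbstractSimplicialComplex P} {k : ℕ} (p : P)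
    {z : ExteriorAlgebra F (P →₀ F)} (hz : z ∈ cycles F K k) :
    vertexContract F p (boundary F P z) = 0 := by
  cases k with
  | zero =>
    change z ∈ Submodule.span F _ at hz
    induction hz using Submodule.span_induction with
    | mem c hc =>
      obtain ⟨x, -, rfl⟩ := hc
      rw [boundary_orientedSimplex]
      simp [vertexContract_orientedSimplex_zero]
    | zero => simp
    | add a b _ _ ha hb => rw [map_add, map_add, ha, hb, add_zero]
    | smul r a _ ha => rw [map_smul, map_smul, ha, smul_zero]
  | succ k => rw [LinearMap.mem_ker.1 hz.2, map_zero]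

variable {K L : PreAbstractSimplicialComplex P} {p q : P}

/-- Only the terms in which `p` is contracted survive; adding back `p` and adding `q` keeps their
vertices inside the simplex `τ` given by domination. -/
theorem moveHomotopy_mem_chains (hdom : ∀ σ ∈ K, p ∈ σ → ∃ τ ∈ K, q ∈ τ ∧ σ ⊆ τ) {k : ℕ}
    {c : ExteriorAlgebra F (P →₀ F)} (hc : c ∈ chains F K k) :
    moveHomotopy F p q c ∈ chains F K (k + 1) := by
  change c ∈ Submodule.span F _ at hc
  induction hc using Submodule.span_induction with
  | mem c hc =>
    obtain ⟨x, ⟨σ, hσ, hx⟩, rfl⟩ := hc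
    rw [moveHomotopy_apply, vertexContract_orientedSimplex, Finset.mul_sum, Finset.mul_sum]
    refine Submodule.sum_mem _ fun i _ => ?_
    rw [mul_smul_comm, mul_smul_comm]
    by_cases hi : x i = p
    · refine Submodule.smul_mem _ _ ?_
      rw [← orientedSimplex_cons, ← orientedSimplex_cons]
      have hp : p ∈ σ := Finset.mem_coe.1 (hx ▸ ⟨i, hi⟩)
      obtain ⟨τ, hτ, hq, hστ⟩ := hdom σ hσ hp
      refine orientedSimplex_mem_chains hτ ?_
      rw [Fin.range_cons, Fin.range_cons]
      refine Set.insert_subset hq (Set.insert_subset (hστ hp) ?_)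
      rintro _ ⟨j, rfl⟩
      exact hστ (Finset.mem_coe.1 (hx ▸ ⟨_, rfl⟩))
    · rw [Finsupp.single_eq_of_ne (Ne.symm hi), mul_zero, zero_smul]
      exact Submodule.zero_mem _
  | zero => rw [map_zero]; exact Submodule.zero_mem _
  | add a b _ _ ha hb => rw [map_add]; exact Submodule.add_mem _ ha hb
  | smul r a _ ha => rw [map_smul]; exact Submodule.smul_mem _ _ ha

theorem moveVertex_mem_chains (hL : ∀ σ ∈ K, p ∉ σ → σ ∈ L) (hpq : p ≠ q)
    (hdom : ∀ σ ∈ K, p ∈ σ → ∃ τ ∈ K, q ∈ τ ∧ σ ⊆ τ) {k : ℕ}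
    {c : ExteriorAlgebra F (P →₀ F)} (hc : c ∈ chains F K k) :
    moveVertex F p q c ∈ chains F L k := by
  classical
  change c ∈ Submodule.span F _ at hc
  induction hc using Submodule.span_induction with
  | mem c hc =>
    obtain ⟨x, ⟨σ, hσ, hx⟩, rfl⟩ := hc
    rw [moveVertex_orientedSimplex]
    have hxσ : ∀ i, x i ∈ σ := fun i => Finset.mem_coe.1 (hx ▸ ⟨i, rfl⟩)
    by_cases hp : p ∈ σ
    · obtain ⟨τ, hτ, hq, hστ⟩ := hdom σ hσ hp
      refine orientedSimplex_mem_chains (σ := τ.erase p) (hL _ ?_ (Finset.notMem_erase _ _)) ?_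
      · exact (K.isRelLowerSet_faces hτ).2 (Finset.erase_subset _ _)
          ⟨q, Finset.mem_erase.2 ⟨hpq.symm, hq⟩⟩
      · rintro _ ⟨i, rfl⟩
        dsimp only
        split_ifs with h
        · exact Finset.mem_erase.2 ⟨hpq.symm, hq⟩
        · exact Finset.mem_erase.2 ⟨h, hστ (hxσ i)⟩
    · refine orientedSimplex_mem_chains (hL σ hσ hp) ?_
      rintro _ ⟨i, rfl⟩
      dsimp only
      rw [if_neg fun h : x i = p => hp (h ▸ hxσ i)]
      exact hxσ i
  | zero => simp [moveVertex]
  | add a b _ _ ha hb =>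
    have : moveVertex F p q (a + b) = moveVertex F p q a + moveVertex F p q b := by
      simp only [moveVertex, map_add, mul_add]; abel
    rw [this]; exact Submodule.add_mem _ ha hb
  | smul r a _ ha =>
    have : moveVertex F p q (r • a) = r • moveVertex F p q a := by
      simp only [moveVertex, map_smul, mul_smul_comm, smul_sub]
    rw [this]; exact Submodule.smul_mem _ _ ha

theorem moveVertex_eq_self (hp : ∀ σ ∈ L, p ∉ σ) {k : ℕ}
    {c : ExteriorAlgebra F (P →₀ F)} (hc : c ∈ chains F L k) :
    moveVertex F p q c = c := by
  have : vertexContract F p c = 0 := by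
    change c ∈ Submodule.span F _ at hc
    induction hc using Submodule.span_induction with
    | mem c hc =>
      obtain ⟨x, ⟨σ, hσ, hx⟩, rfl⟩ := hc
      rw [vertexContract_orientedSimplex]
      refine Finset.sum_eq_zero fun i _ => ?_
      have hi : p ≠ x i := fun h => hp σ hσ (Finset.mem_coe.1 (hx ▸ ⟨i, h.symm⟩))
      rw [Finsupp.single_eq_of_ne hi, mul_zero, zero_smul]
    | zero => simp
    | add a b _ _ ha hb => rw [map_add, ha, hb, add_zero]
    | smul r a _ ha => rw [map_smul, ha, smul_zero]
  rw [moveVertex, this, mul_zero, sub_zero]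

/-- Removing a dominated vertex from a simplicial complex does not change its homology. -/
theorem bijective_homologyMap_of_dominated (h : L ≤ K) (hL : ∀ σ ∈ K, p ∉ σ → σ ∈ L)
    (hp : ∀ σ ∈ L, p ∉ σ) (hpq : p ≠ q)
    (hdom : ∀ σ ∈ K, p ∈ σ → ∃ τ ∈ K, q ∈ τ ∧ σ ⊆ τ) (k : ℕ) :
    Function.Bijective (homologyMap F h k) := by
  constructor
  · rw [injective_iff_map_eq_zero]
    intro y
    obtain ⟨⟨z, hz⟩, rfl⟩ := Submodule.mkQ_surjective _ y
    intro hy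
    have hy' : (Submodule.Quotient.mk ⟨z, cycles_mono F h k hz⟩ : Homology F K k) = 0 := hy
    rw [Submodule.Quotient.mk_eq_zero] at hy'
    obtain ⟨w, hw, hwz⟩ := hy'
    refine (Submodule.Quotient.mk_eq_zero _).2 ?_
    -- Moving `p` to `q` pushes a bounding chain of `K` into `L` and fixes the cycle `z`, which
    -- avoids `p`.
    refine ⟨moveVertex F p q w, moveVertex_mem_chains hL hpq hdom hw, ?_⟩
    rw [boundary_moveVertex, hwz]
    exact moveVertex_eq_self hp (cycles_le_chains L k hz)
  · intro y
    obtain ⟨⟨z, hz⟩, rfl⟩ := Submodule.mkQ_surjective _ y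
    have hz' : moveVertex F p q z ∈ cycles F L k := by
      have h1 := moveVertex_mem_chains hL hpq hdom (cycles_le_chains K k hz)
      cases k with
      | zero => exact h1
      | succ k =>
        refine ⟨h1, ?_⟩
        rw [SetLike.mem_coe, LinearMap.mem_ker, boundary_moveVertex, LinearMap.mem_ker.1 hz.2]
        simp [moveVertex]
    refine ⟨Submodule.mkQ _ ⟨_, hz'⟩, ?_⟩
    symm
    refine (Submodule.Quotient.eq _).2 ?_
    -- The homotopy exhibits `z` and its moved copy as homologous in `K`.
    refine ⟨moveHomotopy F p q z, moveHomotopy_mem_chains hdom (cycles_le_chains K k hz), ?_⟩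
    have h1 := boundary_moveHomotopy F p q z
    rw [moveHomotopy_apply F p q (boundary F P z), vertexContract_boundary_of_mem_cycles p hz,
      mul_zero, mul_zero, add_zero] at h1
    exact h1

end DominatedVertex

/-! ### Functoriality and finite dimension of homology. -/

section Functoriality

variable (F : Type v) [Field F] {P : Type u} {K L M : PreAbstractSimplicialComplex P}

theorem homologyMap_homologyMap (h : K ≤ L) (h' : L ≤ M) (k : ℕ) (x : Homology F K k) :
    homologyMap F h' k (homologyMap F h k x) = homologyMap F (h.trans h') k x := by
  obtain ⟨z, rfl⟩ := Submodule.mkQ_surjective _ x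
  rfl

theorem homologyMap_refl (h : K ≤ K) (k : ℕ) (x : Homology F K k) : homologyMap F h k x = x := by
  obtain ⟨z, rfl⟩ := Submodule.mkQ_surjective _ x
  rfl

theorem bijective_homologyMap_of_eq (h : K ≤ L) (h' : K = L) (k : ℕ) :
    Function.Bijective (homologyMap F h k) := by
  subst h'
  exact ⟨fun x y hxy => by rwa [homologyMap_refl, homologyMap_refl] at hxy,
    fun x => ⟨x, homologyMap_refl F h k x⟩⟩

theorem homologyMap_comp_coe (h : K ≤ L) (h' : L ≤ M) (k : ℕ) :
    ⇑(homologyMap F h' k) ∘ ⇑(homologyMap F h k) = homologyMap F (h.trans h') k :=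
  funext (homologyMap_homologyMap F h h' k)

instance finite_homology [Finite P] (k : ℕ) : Module.Finite F (Homology F K k) := by
  have h1 : (chains F K k).FG := by
    refine Submodule.fg_span ((Set.finite_range fun x : Fin (k + 1) → P =>
      orientedSimplex F x).subset ?_)
    rintro _ ⟨x, -, rfl⟩
    exact ⟨x, rfl⟩
  have : FiniteDimensional F (chains F K k) := Module.Finite.of_fg h1
  have : FiniteDimensional F (cycles F K k) :=
    Submodule.finiteDimensional_of_le (cycles_le_chains K k)
  infer_instance

end Functoriality

/-! ### Deletion times and the net property. -/

section NetTreeFacts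

variable {P : Type u} [MetricSpace P] {Kp : ℝ}

theorem NetTree.finite_points (T : NetTree.{u, w} P Kp) : Finite P :=
  have := T.finite
  Finite.of_surjective T.rep fun p => T.exists_rep p

theorem NetTree.topNode_le (T : NetTree.{u, w} P Kp) {p : P} {x : T.tree} (h : T.rep x = p) :
    T.topNode p ≤ x := by
  have := T.finite
  have hx : x ∈ (Set.toFinite {x | T.rep x = p}).toFinset := (Set.Finite.mem_toFinset _).2 h
  exact Finset.inf'_le (α := T.tree) id hx

/-- A point is covered by every node above the least common ancestor of its nodes. -/
theorem NetTree.dist_rep_le (T : NetTree.{u, w} P Kp) {p : P} {x l : T.tree}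
    (hl : children T.tree l = ∅) (hp : T.rep l = p) (hx : x ≤ l) :
    dist p (T.rep x) ≤ T.rad x :=
  Metric.mem_closedBall.1 (T.covering x ⟨l, ⟨hl, hx⟩, hp⟩)

/-- The parent of `v_p` lies above all nodes represented by `p`, so its representative differs from
`p`; its ball contains `p`, so its radius is positive. -/
theorem NetTree.deletionTime_pos (T : NetTree.{u, w} P Kp) {ε : ℝ} (h0 : 0 < ε) (h1 : ε ≤ 1 / 3)
    (p : P) : 0 < T.deletionTime ε p := by
  classical
  unfold NetTree.deletionTime
  split_ifs with h
  · exact WithTop.coe_lt_top 0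
  · obtain ⟨l, hl, hp⟩ := T.leaves.surjOn (Set.mem_univ p)
    have hlt : Order.pred (T.topNode p) < T.topNode p := Order.pred_lt_of_not_isMin
      fun hm => h hm.eq_bot
    have hd := T.dist_rep_le hl hp (hlt.le.trans (T.topNode_le hp))
    have hne : T.rep (Order.pred (T.topNode p)) ≠ p := fun h' =>
      absurd (T.topNode_le h') (not_le_of_gt hlt)
    have hpos : 0 < T.rad (Order.pred (T.topNode p)) :=
      (dist_pos.2 hne.symm).trans_le hd
    have : 0 < 1 / (ε * (1 - 2 * ε)) := by
      have : 0 < 1 - 2 * ε := by linarith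
      positivity
    exact_mod_cast mul_pos this hpos

/-- The net property: every point is close to a point that is deleted much later than `α`. -/
theorem NetTree.exists_near (T : NetTree.{u, w} P Kp) {ε : ℝ} (h0 : 0 < ε) (h1 : ε ≤ 1 / 3)
    {α : ℝ} (hα : 0 < α) (p : P) : ∃ q, dist p q ≤ ε * α ∧
      ∀ τ : ℝ, T.deletionTime ε q = τ → α ≤ (1 - 2 * ε) * τ := by
  classical
  have := T.finite
  obtain ⟨l, hl, hp⟩ := T.leaves.surjOn (Set.mem_univ p)
  -- Climb from the leaf of `p` towards the root until the representative has a late enough deletion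
  -- time.
  have key : ∀ y : T.tree, y ≤ l → dist p (T.rep y) ≤ ε * α → ∃ q, dist p q ≤ ε * α ∧
      ∀ τ : ℝ, T.deletionTime ε q = τ → α ≤ (1 - 2 * ε) * τ := by
    intro y
    induction y using WellFoundedLT.induction with
    | ind y ih =>
      intro hy hd
      by_cases hgood : ∀ τ : ℝ, T.deletionTime ε (T.rep y) = τ → α ≤ (1 - 2 * ε) * τ
      · exact ⟨_, hd, hgood⟩
      -- If `rep y` is deleted too early, the parent of its top node has radius `ε(1 - 2ε)τ < εα`.
      -- Being an ancestor of the leaf of `p`, that parent is strictly higher and still within `εα`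
      -- of `p`.
      · push Not at hgood
        obtain ⟨τ, hτ, hlt⟩ := hgood
        unfold NetTree.deletionTime at hτ
        split_ifs at hτ with h
        · exact absurd hτ WithTop.top_ne_coe
        set x := T.topNode (T.rep y) with hx
        have hxl : Order.pred x < x := Order.pred_lt_of_not_isMin fun hm => h hm.eq_bot
        have hxy : x ≤ y := T.topNode_le rfl
        refine ih (Order.pred x) (hxl.trans_le hxy) (hxl.le.trans (hxy.trans hy)) ?_
        refine (T.dist_rep_le hl hp (hxl.le.trans (hxy.trans hy))).trans ?_
        have hτ' := WithTop.coe_injective hτ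
        have he : 0 < 1 - 2 * ε := by linarith
        have : T.rad (Order.pred x) = ε * ((1 - 2 * ε) * τ) := by
          rw [← hτ', ← mul_assoc, ← mul_assoc, mul_one_div_cancel (mul_pos h0 he).ne', one_mul]
        rw [this]
        gcongr
  exact key l le_rfl (by rw [hp, dist_self]; positivity)

end NetTreeFacts

/-! ### Successive removal of dominated vertices. -/

section Collapse

variable {P : Type u}

/-- The subcomplex of the simplices with all vertices in `X`. -/
def restrictTo (K : PreAbstractSimplicialComplex P) (X : Set P) :
    PreAbstractSimplicialComplex P where
  faces := {σ | σ ∈ K ∧ (σ : Set P) ⊆ X}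
  isRelLowerSet_faces := by
    rintro σ ⟨hσ, hX⟩
    refine ⟨(K.isRelLowerSet_faces hσ).1, fun τ hτ hne => ⟨?_, fun p hp => hX (hτ hp)⟩⟩
    exact (K.isRelLowerSet_faces hσ).2 hτ hne

theorem restrictTo_le (K : PreAbstractSimplicialComplex P) (X : Set P) : restrictTo K X ≤ K :=
  fun _ h => h.1

/-- Removing vertices in decreasing order of their deletion times, each of which is dominated by a
vertex that is deleted later, does not change the homology. -/
theorem bijective_homologyMap_restrictTo (F : Type v) [Field F] {τ : Type w} [LinearOrder τ]
    (t : P → τ) (K : PreAbstractSimplicialComplex P) (R : Finset P)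
    (hR : ∀ p ∈ R, ∀ r ∉ R, t p ≤ t r)
    (hdom : ∀ p ∈ R, ∃ q, t p < t q ∧
      ∀ σ ∈ K, p ∈ σ → (∀ r ∈ σ, t p ≤ t r) → ∃ σ' ∈ K, q ∈ σ' ∧ σ ⊆ σ' ∧
        ∀ r ∈ σ', r = q ∨ r ∈ σ) (k : ℕ) :
    Function.Bijective (homologyMap F (restrictTo_le K (R : Set P)ᶜ) k) := by
  classical
  induction hn : R.card generalizing R with
  | zero =>
    refine bijective_homologyMap_of_eq F _ (le_antisymm (restrictTo_le _ _) ?_) k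
    intro σ hσ
    refine ⟨hσ, fun p _ => ?_⟩
    rw [Finset.card_eq_zero.1 hn]
    simp
  | succ n ih =>
    -- A vertex of `R` with the latest deletion time is removed last: when its turn comes, no
    -- remaining vertex has an earlier deletion time.
    obtain ⟨p, hp, hmax⟩ := R.exists_max_image t (Finset.card_pos.1 (by omega))
    have ih' := ih (R.erase p) ?_ (fun r hr => hdom r (Finset.mem_of_mem_erase hr))
      (by rw [Finset.card_erase_of_mem hp, hn]; rfl)
    swap
    · intro r hr s hs
      by_cases hsp : s = p
      · exact hsp ▸ hmax r (Finset.mem_of_mem_erase hr)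
      · exact hR r (Finset.mem_of_mem_erase hr) s fun h => hs (Finset.mem_erase.2 ⟨hsp, h⟩)
    obtain ⟨q, hpq, hq⟩ := hdom p hp
    -- The strict inequality keeps the dominating vertex in the final complex.
    have hqR : q ∉ R := fun h => not_le_of_gt hpq (hmax q h)
    have hle : restrictTo K (R : Set P)ᶜ ≤ restrictTo K ((R.erase p : Finset P) : Set P)ᶜ := by
      rintro σ ⟨hσ, hX⟩
      exact ⟨hσ, fun r hr h => hX hr (Finset.mem_of_mem_erase h)⟩
    have h1 : Function.Bijective (homologyMap F hle k) := by
      refine bijective_homologyMap_of_dominated hle (p := p) (q := q) ?_ ?_ ?_ ?_ k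
      · rintro σ ⟨hσ, hX⟩ hpσ
        refine ⟨hσ, fun r hr h => hX hr (Finset.mem_coe.2 (Finset.mem_erase.2 ⟨?_, h⟩))⟩
        rintro rfl
        exact hpσ hr
      · rintro σ ⟨-, hX⟩ hpσ
        exact hX hpσ hp
      · rintro rfl
        exact hpq.false
      · rintro σ ⟨hσ, hX⟩ hpσ
        have hmin : ∀ r ∈ σ, t p ≤ t r := by
          intro r hr
          by_cases hrp : r = p
          · rw [hrp]
          · exact hR p hp r fun h => hX hr (Finset.mem_coe.2 (Finset.mem_erase.2 ⟨hrp, h⟩))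
        obtain ⟨σ', hσ', hqσ', hsub, hsup⟩ := hq σ hσ hpσ hmin
        refine ⟨σ', ⟨hσ', fun r hr h => ?_⟩, hqσ', hsub⟩
        rcases hsup r hr with rfl | hrσ
        · exact hqR (Finset.mem_of_mem_erase h)
        · exact hX hrσ h
    rw [← homologyMap_comp_coe F hle (restrictTo_le _ _)]
    exact ih'.comp h1

theorem mem_iSup_complex {ι : Sort w} (K : ι → PreAbstractSimplicialComplex P) {σ : Finset P} :
    σ ∈ ⨆ i, K i ↔ ∃ i, σ ∈ K i := by
  refine Set.mem_iUnion₂.trans ⟨?_, fun ⟨i, hi⟩ => ⟨K i, ⟨i, rfl⟩, hi⟩⟩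
  rintro ⟨_, ⟨i, rfl⟩, hi⟩
  exact ⟨i, hi⟩

end Collapse

/-! ### The sparse complexes as full subcomplexes of the union. -/

section SparseComplexes

variable {P : Type u} [MetricSpace P] {ε : ℝ} {A : Set ℝ}

theorem mem_unionComplex {t : P → WithTop ℝ} {a : A} {σ : Finset P} :
    σ ∈ unionComplex ε t A a ↔ ∃ b : A, b ≤ a ∧ σ ∈ closedComplex ε t b := by
  simp only [unionComplex, mem_iSup_complex, exists_prop]

theorem closedComplex_le_unionComplex (t : P → WithTop ℝ) (a : A) :
    closedComplex ε t a ≤ unionComplex ε t A a :=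
  fun _ h => mem_unionComplex.2 ⟨a, le_rfl, h⟩

theorem unionComplex_mono (t : P → WithTop ℝ) {a b : A} (h : a ≤ b) :
    unionComplex ε t A a ≤ unionComplex ε t A b :=
  fun _ hσ => let ⟨c, hc, hσ'⟩ := mem_unionComplex.1 hσ
    mem_unionComplex.2 ⟨c, hc.trans h, hσ'⟩

/-- A simplex of the union belongs to some `cl Q_b`, where `b` is at most the deletion time of each
of its vertices. Edges persist as the scale grows, so it suffices that `b ≤ α`. This is applied with
`α = a` and with `α = t_p`. -/
theorem mem_vietorisRips_of_mem_unionComplex (h0 : 0 < ε) (h1 : ε ≤ 1 / 3) {t : P → WithTop ℝ}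
    (hA : IsScaleSet ε t A) {a : A} {σ : Finset P} (hσ : σ ∈ unionComplex ε t A a) {p : P}
    (hp : p ∈ σ) {α : ℝ} (h : ∀ b : A, b ≤ a → (b : WithTop ℝ) ≤ t p → (b : ℝ) ≤ α)
    {X : Set P} (hX : (σ : Set P) ⊆ X) : σ ∈ vietorisRips X (relaxedDist ε t α) α := by
  obtain ⟨b, hb, hσb⟩ := mem_unionComplex.1 hσ
  have h2 := vietorisRips_mono h0 h1 t (hA.nonneg b b.2) (h b hb (hσb.2.1 hp))
    (Set.subset_univ _) hσb
  exact ⟨h2.1, hX, h2.2.2⟩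

theorem closedComplex_eq_restrictTo (h0 : 0 < ε) (h1 : ε ≤ 1 / 3) {t : P → WithTop ℝ}
    (hA : IsScaleSet ε t A) (a : A) :
    closedComplex ε t a = restrictTo (unionComplex ε t A a) (closedNet t a) := by
  refine le_antisymm (fun σ hσ => ⟨closedComplex_le_unionComplex t a hσ, hσ.2.1⟩) ?_
  rintro σ ⟨hσ, hX⟩
  obtain ⟨p, hp⟩ := ((unionComplex ε t A a).isRelLowerSet_faces hσ).1
  exact mem_vietorisRips_of_mem_unionComplex h0 h1 hA hσ hp (fun b hb _ => hb) hX

theorem openComplex_eq_restrictTo (h0 : 0 < ε) (h1 : ε ≤ 1 / 3) {t : P → WithTop ℝ}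
    (hA : IsScaleSet ε t A) (a : A) :
    openComplex ε t a = restrictTo (unionComplex ε t A a) (openNet t a) := by
  refine le_antisymm (fun σ hσ => ⟨closedComplex_le_unionComplex t a
    (openComplex_le_closedComplex h0 h1 t (hA.nonneg a a.2) hσ), hσ.2.1⟩) ?_
  rintro σ ⟨hσ, hX⟩
  obtain ⟨p, hp⟩ := ((unionComplex ε t A a).isRelLowerSet_faces hσ).1
  exact mem_vietorisRips_of_mem_unionComplex h0 h1 hA hσ hp (fun b hb _ => hb) hX

/-- At its deletion time, a point is dominated by a point that is deleted later. -/
theorem exists_dominating {Kp : ℝ} (T : NetTree.{u, w} P Kp) (h0 : 0 < ε) (h1 : ε ≤ 1 / 3)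
    (hA : IsScaleSet ε (T.deletionTime ε) A) (a : A) (p : P)
    (hpa : T.deletionTime ε p ≤ ((a : ℝ) : WithTop ℝ)) :
    ∃ q, T.deletionTime ε p < T.deletionTime ε q ∧
      ∀ σ ∈ unionComplex ε (T.deletionTime ε) A a, p ∈ σ →
        (∀ r ∈ σ, T.deletionTime ε p ≤ T.deletionTime ε r) →
        ∃ σ' ∈ unionComplex ε (T.deletionTime ε) A a, q ∈ σ' ∧ σ ⊆ σ' ∧
          ∀ r ∈ σ', r = q ∨ r ∈ σ := by
  classical
  obtain ⟨τ, hτ⟩ := WithTop.ne_top_iff_exists.1 (ne_top_of_le_ne_top WithTop.coe_ne_top hpa)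
  have hpos : 0 < τ := by
    have := T.deletionTime_pos h0 h1 p
    rw [← hτ] at this
    exact_mod_cast this
  obtain ⟨q, hd, hq⟩ := T.exists_near h0 h1 hpos p
  have he : 0 < 1 - 2 * ε := by linarith
  have hpq : T.deletionTime ε p < T.deletionTime ε q := by
    rw [← hτ]
    rcases eq_or_ne (T.deletionTime ε q) ⊤ with h | h
    · rw [h]; exact WithTop.coe_lt_top τ
    · obtain ⟨s, hs⟩ := WithTop.ne_top_iff_exists.1 h
      rw [← hs]
      have := hq s hs.symm
      exact_mod_cast (by nlinarith : τ < s)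
  -- The factor `1 - 2ε` in `exists_near` is there for this: the weight of `q` has not begun to grow
  -- at scale `τ`.
  have hwq : weight ε (T.deletionTime ε q) τ = 0 := by
    rcases eq_or_ne (T.deletionTime ε q) ⊤ with h | h
    · rw [h]; rfl
    · obtain ⟨s, hs⟩ := WithTop.ne_top_iff_exists.1 h
      rw [← hs]
      simp only [weight]
      rw [if_pos (hq s hs.symm)]
  have hwp : weight ε (T.deletionTime ε p) τ = ε * τ := by
    rw [← hτ]
    simp only [weight]
    rw [if_neg (by nlinarith), if_neg (lt_irrefl _)]
  refine ⟨q, hpq, fun σ hσ hp hmin => ?_⟩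
  -- Since `p ∈ σ`, the simplex entered the union no later than `t_p = τ`, so it can be examined at
  -- scale `τ` instead of `a`.
  have hσ' : σ ∈ closedComplex ε (T.deletionTime ε) τ := by
    refine mem_vietorisRips_of_mem_unionComplex h0 h1 hA hσ hp ?_ fun r hr => ?_
    · intro b _ hb
      rw [← hτ] at hb
      exact_mod_cast hb
    · change (τ : WithTop ℝ) ≤ _
      rw [hτ]
      exact hmin r hr
  -- The detour through `p` costs `d(p,q) ≤ ετ`, which is exactly the weight of `p` that is replaced
  -- by the zero weight of `q`.
  have hqr : ∀ r ∈ σ, relaxedDist ε (T.deletionTime ε) τ q r ≤ τ := by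
    intro r hr
    have h2 := hσ'.2.2 p hp r hr
    have h3 := dist_triangle_left q r p
    simp only [relaxedDist] at h2 ⊢
    rw [hwp] at h2
    rw [hwq]
    linarith
  have hcomm : ∀ r s, relaxedDist ε (T.deletionTime ε) τ r s =
      relaxedDist ε (T.deletionTime ε) τ s r := by
    intro r s
    simp only [relaxedDist, dist_comm r s]
    ring
  -- The enlarged simplex lives in `cl Q_τ`, which is part of the union at `a` because `τ` is a
  -- deletion time, hence in `A`, and `τ ≤ a`.
  refine ⟨insert q σ, mem_unionComplex.2 ⟨⟨τ, hA.deletion_mem p τ hτ.symm⟩, ?_, ?_⟩,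
    Finset.mem_insert_self _ _, Finset.subset_insert _ _, fun r hr => Finset.mem_insert.1 hr⟩
  · rw [← hτ] at hpa
    exact_mod_cast hpa
  · refine ⟨Finset.insert_nonempty _ _, ?_, ?_⟩
    · intro r hr
      rcases Finset.mem_insert.1 (Finset.mem_coe.1 hr) with rfl | hr
      · change (τ : WithTop ℝ) ≤ _
        rw [hτ]
        exact hpq.le
      · exact hσ'.2.1 hr
    · intro r hr s hs
      rcases Finset.mem_insert.1 hr with rfl | hr' <;>
        rcases Finset.mem_insert.1 hs with rfl | hs'
      · simp only [relaxedDist, hwq, dist_self]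
        simpa using hpos.le
      · exact hqr s hs'
      · rw [hcomm]
        exact hqr r hr'
      · exact hσ'.2.2 r hr' s hs'

/-- Common form of the open and closed cases: the points outside the net `X` are finitely many, are
all deleted by `a`, and none is deleted after a point of `X`. -/
theorem bijective_homologyMap_net {Kp : ℝ} (T : NetTree.{u, w} P Kp) (h0 : 0 < ε)
    (h1 : ε ≤ 1 / 3) (hA : IsScaleSet ε (T.deletionTime ε) A) (F : Type v) [Field F] (k : ℕ)
    (a : A) {X : Set P}
    (hXa : ∀ p ∉ X, T.deletionTime ε p ≤ ((a : ℝ) : WithTop ℝ))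
    (hup : ∀ p ∉ X, ∀ r ∈ X, T.deletionTime ε p ≤ T.deletionTime ε r)
    {L : PreAbstractSimplicialComplex P}
    (hL : L = restrictTo (unionComplex ε (T.deletionTime ε) A a) X)
    (h : L ≤ unionComplex ε (T.deletionTime ε) A a) :
    Function.Bijective (homologyMap F h k) := by
  classical
  have := T.finite_points
  have hc : (((Set.toFinite Xᶜ).toFinset : Finset P) : Set P)ᶜ = X := by simp
  rw [← hc] at hL
  subst hL
  refine bijective_homologyMap_restrictTo F (T.deletionTime ε) _ _ ?_ ?_ k
  · intro p hp r hr
    rw [Set.Finite.mem_toFinset] at hp hr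
    exact hup p hp r (not_not.1 hr)
  · intro p hp
    rw [Set.Finite.mem_toFinset] at hp
    exact exists_dominating T h0 h1 hA a p (hXa p hp)

theorem bijective_homologyMap_closedComplex {Kp : ℝ} (T : NetTree.{u, w} P Kp) (h0 : 0 < ε)
    (h1 : ε ≤ 1 / 3) (hA : IsScaleSet ε (T.deletionTime ε) A) (F : Type v) [Field F] (k : ℕ)
    (a : A) (h : closedComplex ε (T.deletionTime ε) a ≤ unionComplex ε (T.deletionTime ε) A a) :
    Function.Bijective (homologyMap F h k) :=
  bijective_homologyMap_net T h0 h1 hA F k a (X := closedNet (T.deletionTime ε) a)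
    (fun _ hp => (lt_of_not_ge hp).le) (fun _ hp _ hr => (lt_of_not_ge hp).le.trans hr)
    (closedComplex_eq_restrictTo h0 h1 hA a) h

theorem bijective_homologyMap_openComplex {Kp : ℝ} (T : NetTree.{u, w} P Kp) (h0 : 0 < ε)
    (h1 : ε ≤ 1 / 3) (hA : IsScaleSet ε (T.deletionTime ε) A) (F : Type v) [Field F] (k : ℕ)
    (a : A) (h : openComplex ε (T.deletionTime ε) a ≤ unionComplex ε (T.deletionTime ε) A a) :
    Function.Bijective (homologyMap F h k) :=
  bijective_homologyMap_net T h0 h1 hA F k a (X := openNet (T.deletionTime ε) a)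
    (fun _ hp => le_of_not_gt hp) (fun _ hp _ hr => (le_of_not_gt hp).trans hr.le)
    (openComplex_eq_restrictTo h0 h1 hA a) h

/-- Two out of three: both complexes include into the union with an isomorphism on homology. -/
theorem bijective_openComplex_closedComplex {Kp : ℝ} (T : NetTree.{u, w} P Kp) (h0 : 0 < ε)
    (h1 : ε ≤ 1 / 3) (hA : IsScaleSet ε (T.deletionTime ε) A) (F : Type v) [Field F] (k : ℕ)
    (a : A) : Function.Bijective (homologyMap F
      (openComplex_le_closedComplex h0 h1 (T.deletionTime ε) (hA.nonneg a a.2)) k) := by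
  have h := closedComplex_le_unionComplex (ε := ε) (T.deletionTime ε) a
  refine (Function.Bijective.of_comp_iff'
    (bijective_homologyMap_closedComplex T h0 h1 hA F k a h) _).1 ?_
  rw [homologyMap_comp_coe]
  exact bijective_homologyMap_openComplex T h0 h1 hA F k a _

end SparseComplexes

/-! ### Bases adapted to a chain of subspaces. -/

section Adapted

variable {F : Type v} [Field F]

/-- A chain of subspaces of a finite-dimensional space has an adapted basis. -/
theorem exists_adapted_linearIndepOn {W : Type w} [AddCommGroup W] [Module F W]
    [FiniteDimensional F W] {ι : Type u} [LinearOrder ι] {K : ι → Submodule F W}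
    (hK : Monotone K) (U : Submodule F W) :
    ∃ s : Set W, LinearIndepOn F id s ∧ Submodule.span F s = U ∧
      ∀ i, K i ≤ U → Submodule.span F (s ∩ K i) = K i := by
  induction U using WellFoundedLT.induction with
  | ind U ih =>
    -- Extending to a basis of `U` preserves adaptedness to the proper members of the chain; members
    -- equal to `U` are spanned by the whole basis.
    have extend : ∀ s : Set W, LinearIndepOn F id s → s ⊆ U →
        (∀ j, K j < U → Submodule.span F (s ∩ K j) = K j) →
        ∃ s : Set W, LinearIndepOn F id s ∧ Submodule.span F s = U ∧
          ∀ i, K i ≤ U → Submodule.span F (s ∩ K i) = K i := by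
      intro s hs hsU hj
      obtain ⟨b, hbU, hsb, hUb, hb⟩ := exists_linearIndepOn_id_extension hs hsU
      have hspan : Submodule.span F b = U := le_antisymm (Submodule.span_le.2 hbU) hUb
      refine ⟨b, hb, hspan, fun i hi => ?_⟩
      rcases hi.eq_or_lt with h | h
      · rw [h, Set.inter_eq_left.2 hbU, hspan]
      · refine le_antisymm (Submodule.span_le.2 Set.inter_subset_right) ?_
        rw [← hj i h]
        refine Submodule.span_mono ?_
        rw [hj i h]
        exact Set.inter_subset_inter_left _ hsb
    by_cases hex : ∃ i, K i < U
    · obtain ⟨V, ⟨⟨i, rfl⟩, hi⟩, hmax⟩ := wellFounded_gt.has_min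
        {V : Submodule F W | (∃ i, K i = V) ∧ V < U} (let ⟨i, hi⟩ := hex; ⟨K i, ⟨i, rfl⟩, hi⟩)
      obtain ⟨s, hs, hspan, hadapt⟩ := ih (K i) hi
      refine extend s hs ?_ fun j hj => hadapt j ?_
      · intro x hx
        exact hi.le (hspan ▸ Submodule.subset_span hx)
      · rcases le_total j i with h | h
        · exact hK h
        · rcases (hK h).eq_or_lt with h' | h'
          · exact h'.ge
          · exact absurd h' (hmax (K j) ⟨⟨j, rfl⟩, hj⟩)
    · push Not at hex
      exact extend ∅ (linearIndepOn_empty F id) (Set.empty_subset _)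
        fun j hj => absurd hj (hex j)

/-- Indexing by `Fin n` keeps the index type of the bars in `Type`, whatever the universe of `W`. -/
theorem exists_adapted_basis {W : Type w} [AddCommGroup W] [Module F W]
    [FiniteDimensional F W] {ι : Type u} [LinearOrder ι] {K : ι → Submodule F W}
    (hK : Monotone K) : ∃ (n : ℕ) (e : Module.Basis (Fin n) F W),
      ∀ i, K i ≤ Submodule.span F {w | ∃ j, e j = w ∧ w ∈ K i} := by
  obtain ⟨s, hs, hspan, hadapt⟩ := exists_adapted_linearIndepOn hK ⊤
  let b : Module.Basis s F W := Module.Basis.mk hs (by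
    rw [← hspan]; exact Submodule.span_mono fun x hx => ⟨⟨x, hx⟩, rfl⟩)
  have hfin : Finite s := Module.Finite.finite_basis b
  refine ⟨Nat.card s, b.reindex (Finite.equivFin s), fun i => ?_⟩
  rw [← hadapt i le_top]
  refine Submodule.span_mono ?_
  rw [hadapt i le_top]
  rintro x ⟨hx, hxi⟩
  exact ⟨Finite.equivFin s ⟨x, hx⟩, by
    rw [Module.Basis.reindex_apply, Equiv.symm_apply_apply]
    exact Module.Basis.mk_apply _ _ _, hxi⟩

end Adapted

/-! ### Persistence modules and the classes born at an index. -/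

section Persistence

variable {F : Type v} [Field F] {ι : Type u} [LinearOrder ι]

/-- The zigzag module `M` is the restriction of the functor with the transition maps `f`. -/
structure IsPersistence (M : ZigzagModule.{u, v, w} F ι)
    (f : ∀ {a b : ι}, a ≤ b → M.space a →ₗ[F] M.space b) : Prop where
  finite_Iic : ∀ a : ι, (Set.Iic a).Finite
  finite_space : ∀ a, Module.Finite F (M.space a)
  map_refl : ∀ a x, f (le_refl a) x = x
  map_map : ∀ {a b c} (h : a ≤ b) (h' : b ≤ c) x, f h' (f h x) = f (h.trans h') x
  arrow_iff : ∀ {a b}, M.arrow a b ↔ a ⋖ b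
  map_arrow : ∀ {a b} (h : M.arrow a b), M.map h = f (arrow_iff.1 h).le

variable {M : ZigzagModule.{u, v, w} F ι} {f : ∀ {a b : ι}, a ≤ b → M.space a →ₗ[F] M.space b}

namespace IsPersistence

theorem wellFoundedLT (hM : IsPersistence M f) : WellFoundedLT ι := by
  refine ⟨wellFounded_iff_isEmpty_descending_chain.2 ⟨?_⟩⟩
  rintro ⟨g, hg⟩
  have hanti : StrictAnti g := strictAnti_nat_of_succ_lt hg
  exact Set.infinite_range_of_injective hanti.injective ((hM.finite_Iic (g 0)).subset (by
    rintro _ ⟨n, rfl⟩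
    exact hanti.antitone (Nat.zero_le n)))

/-- Finite initial segments give every non-minimal index a predecessor, so transition maps can be
handled one arrow at a time. -/
theorem exists_covBy (hM : IsPersistence M f) {a b : ι} (h : a < b) : ∃ c, a ≤ c ∧ c ⋖ b := by
  have hfin : (Set.Ico a b).Finite := (hM.finite_Iic b).subset fun x hx => hx.2.le
  obtain ⟨c, ⟨hc, hmax⟩⟩ := hfin.exists_maximal ⟨a, le_rfl, h⟩
  refine ⟨c, hc.1, hc.2, fun x hcx hxb => ?_⟩
  exact absurd (hmax (y := x) ⟨hc.1.trans hcx.le, hxb⟩ hcx.le) (not_le_of_gt hcx)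

/-- The span of the images of the earlier spaces. -/
def earlier (f : ∀ {a b : ι}, a ≤ b → M.space a →ₗ[F] M.space b) (a : ι) :
    Submodule F (M.space a) :=
  ⨆ b : Set.Iio a, LinearMap.range (f b.2.le)

theorem mem_earlier {a b : ι} (h : b < a) (x : M.space b) : f h.le x ∈ earlier f a :=
  Submodule.mem_iSup_of_mem (⟨b, h⟩ : Set.Iio a) ⟨x, rfl⟩

/-- Generators of the classes born at `a`, adapted to the kernels of the transition maps, with dual
forms. -/
theorem exists_births (hM : IsPersistence M f) (a : ι) :
    ∃ (n : ℕ) (g : Fin n → M.space a) (φ : Fin n → M.space a →ₗ[F] F),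
      earlier f a ⊔ Submodule.span F (Set.range g) = ⊤ ∧
      (∀ j, ∀ x ∈ earlier f a, φ j x = 0) ∧ (∀ j, φ j (g j) = 1) ∧
      (∀ i j, i ≠ j → φ i (g j) = 0) ∧
      ∀ m (h : a ≤ m) x, f h x = 0 →
        x ∈ earlier f a ⊔ Submodule.span F {y | ∃ j, g j = y ∧ f h y = 0} := by
  have := hM.wellFoundedLT
  have := hM.finite_space a
  -- Work modulo the earlier classes: `K m` consists of the new classes at `a` that have a
  -- representative dead at `m`.
  let K : Set.Ici a → Submodule F (M.space a ⧸ earlier f a) := fun m =>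
    (LinearMap.ker (f m.2)).map (earlier f a).mkQ
  have hker : ∀ {m m' : ι} (h : a ≤ m) (h' : m ≤ m') x, f h x = 0 → f (h.trans h') x = 0 := by
    intro m m' h h' x hx
    rw [← hM.map_map h h', hx, map_zero]
  have hK : Monotone K := fun m m' h => Submodule.map_mono fun x hx => hker m.2 h x hx
  obtain ⟨n, e, he⟩ := exists_adapted_basis hK
  -- Lift `e j` to a vector dying at the first possible `m`. It is then zero at every later index,
  -- so one lift serves all `m` simultaneously.
  have lift : ∀ j, ∃ y : M.space a, (earlier f a).mkQ y = e j ∧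
      ∀ m : Set.Ici a, e j ∈ K m → f m.2 y = 0 := by
    intro j
    by_cases hex : ∃ m, e j ∈ K m
    · obtain ⟨m, hm, hmin⟩ := wellFounded_lt.has_min {m | e j ∈ K m} hex
      obtain ⟨y, hy, hye⟩ := hm
      exact ⟨y, hye, fun m' hm' => hker m.2 (not_lt.1 (hmin m' hm')) y hy⟩
    · obtain ⟨y, hy⟩ := Submodule.mkQ_surjective _ (e j)
      exact ⟨y, hy, fun m hm => absurd ⟨m, hm⟩ hex⟩
  choose g hge hgK using lift
  refine ⟨n, g, fun j => e.coord j ∘ₗ (earlier f a).mkQ, ?_, ?_, ?_, ?_, ?_⟩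
  · rw [← Submodule.comap_map_mkQ, Submodule.map_span, ← Set.range_comp]
    have : (⇑(earlier f a).mkQ ∘ g) = e := funext hge
    rw [this, e.span_eq, Submodule.comap_top]
  · intro j x hx
    have : (earlier f a).mkQ x = 0 := (Submodule.Quotient.mk_eq_zero _).2 hx
    rw [LinearMap.comp_apply, this, map_zero]
  · intro j
    simp [hge]
  · intro i j hij
    rw [LinearMap.comp_apply, hge, e.coord_apply, e.repr_self, Finsupp.single_eq_of_ne hij]
  · intro m h x hx
    rw [← Submodule.comap_map_mkQ, Submodule.mem_comap, Submodule.map_span]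
    have hmem : (earlier f a).mkQ x ∈ K ⟨m, h⟩ := ⟨x, hx, rfl⟩
    refine Submodule.span_mono ?_ (he ⟨m, h⟩ hmem)
    rintro _ ⟨j, rfl, hj⟩
    exact ⟨g j, ⟨j, rfl, hgK j ⟨m, h⟩ hj⟩, hge j⟩

end IsPersistence

end Persistence

/-! ### Existence of interval decompositions. -/

section Existence

variable {F : Type v} [Field F] {ι : Type} [LinearOrder ι]
  {M : ZigzagModule.{0, v, w} F ι} {f : ∀ {a b : ι}, a ≤ b → M.space a →ₗ[F] M.space b}

/-- A persistence module of finite-dimensional spaces over an index set with finite initial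
segments is a direct sum of interval modules. -/
theorem IsPersistence.exists_intervalDecomposition (hM : IsPersistence M f) :
    ∃ B : Type, Nonempty (IntervalDecomposition M B) := by
  classical
  have := hM.wellFoundedLT
  choose n g φ htop hφ0 hφ1 hφne hker using hM.exists_births
  -- Each chosen generator spans one interval: from its birth for as long as its image is nonzero.
  let bar : (Σ a : ι, Fin (n a)) → Set ι := fun β => {m | ∃ h : β.1 ≤ m, f h (g β.1 β.2) ≠ 0}
  let vec : ∀ m, {β // m ∈ bar β} → M.space m := fun m β => f β.2.1 (g β.1.1 β.1.2)
  have hvec : ∀ (β : Σ a : ι, Fin (n a)) {m : ι} (h : β.1 ≤ m),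
      f h (g β.1 β.2) ∈ Submodule.span F (Set.range (vec m)) := by
    intro β m h
    by_cases h0 : f h (g β.1 β.2) = 0
    · rw [h0]; exact Submodule.zero_mem _
    · exact Submodule.subset_span ⟨⟨β, h, h0⟩, rfl⟩
  have hspan : ∀ m, ⊤ ≤ Submodule.span F (Set.range (vec m)) := by
    intro m
    induction m using WellFoundedLT.induction with
    | ind m ih =>
      rw [← htop m]
      refine sup_le (iSup_le fun b => ?_) (Submodule.span_le.2 ?_)
      · rw [LinearMap.range_eq_map]
        refine (Submodule.map_mono (ih b b.2)).trans ?_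
        rw [Submodule.map_span_le]
        rintro _ ⟨β, rfl⟩
        change f _ (f _ _) ∈ _
        rw [hM.map_map]
        exact hvec _ _
      · rintro _ ⟨j, rfl⟩
        rw [← hM.map_refl m (g m j)]
        exact hvec ⟨m, j⟩ le_rfl
  -- Given a relation at `m`, take a term of latest birth `a` and pull the relation back to `a`. The
  -- pulled-back sum dies at `m`, so modulo earlier classes it involves only generators dead at `m`,
  -- whereas the chosen generator is alive there.
  have hind : ∀ m, LinearIndependent F (vec m) := by
    intro m
    rw [linearIndependent_iff']
    intro s c hc
    by_contra! hne
    obtain ⟨i₁, hi₁, hci₁⟩ := hne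
    obtain ⟨i₀, hi₀, hmax⟩ := (s.filter fun i => c i ≠ 0).exists_max_image (fun i => i.1.1)
      ⟨i₁, Finset.mem_filter.2 ⟨hi₁, hci₁⟩⟩
    rw [Finset.mem_filter] at hi₀
    obtain ⟨⟨⟨a, j₀⟩, ham, halive⟩, hi₀s⟩ : ∃ i, i = i₀ := ⟨i₀, rfl⟩
    subst hi₀s
    dsimp only at ham halive hmax
    -- The default 0 never enters: all terms with nonzero coefficient are born by `a`.
    let w : {β // m ∈ bar β} → M.space a := fun i =>
      if h : i.1.1 ≤ a then f h (g i.1.1 i.1.2) else 0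
    have hle : ∀ i ∈ s.filter (fun i => c i ≠ 0), i.1.1 ≤ a := hmax
    have hx0 : f ham (∑ i ∈ s.filter (fun i => c i ≠ 0), c i • w i) = 0 := by
      rw [map_sum, ← hc, Finset.sum_filter]
      refine Finset.sum_congr rfl fun i hi => ?_
      split_ifs with h
      · have h' := hle i (Finset.mem_filter.2 ⟨hi, h⟩)
        simp only [w, dif_pos h', map_smul, hM.map_map, vec]
      · rw [not_not.1 h, zero_smul]
    have h1 : φ a j₀ (∑ i ∈ s.filter (fun i => c i ≠ 0), c i • w i) = 0 := by
      have hmem := hker a m ham _ hx0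
      have hsub : earlier f a ⊔ Submodule.span F {y | ∃ j, g a j = y ∧ f ham y = 0} ≤
          LinearMap.ker (φ a j₀) := by
        refine sup_le (fun x hx => hφ0 a j₀ x hx) (Submodule.span_le.2 ?_)
        rintro _ ⟨j, rfl, hj⟩
        refine hφne a j₀ j ?_
        rintro rfl
        exact halive hj
      exact hsub hmem
    -- The form `φ a j₀` kills earlier births and the other generators at `a`, which leaves the
    -- coefficient of the chosen term.
    rw [map_sum, Finset.sum_eq_single_of_mem _ (Finset.mem_filter.2 hi₀)] at h1
    · simp only [w, le_refl, dif_pos, hM.map_refl, map_smul, hφ1, smul_eq_mul, mul_one] at h1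
      exact hi₀.2 h1
    · rintro ⟨⟨b, j⟩, hb⟩ hi hne
      have hba : b ≤ a := hle _ hi
      simp only [w, dif_pos hba, map_smul]
      rcases hba.eq_or_lt with rfl | hlt
      · rw [hM.map_refl, hφne, smul_zero]
        rintro rfl
        exact hne rfl
      · rw [hφ0 a j₀ _ (mem_earlier hlt _), smul_zero]
  refine ⟨{β : Σ a : ι, Fin (n a) // (bar β).Nonempty}, ⟨?_⟩⟩
  exact
    { bar := fun β => bar β.1
      bar_nonempty := fun β => β.2
      bar_ordConnected := fun β => ⟨by
        rintro x ⟨hx, hx0⟩ z ⟨hz, hz0⟩ y ⟨hxy, hyz⟩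
        refine ⟨hx.trans hxy, fun h0 => hz0 ?_⟩
        rw [← hM.map_map (hx.trans hxy) hyz, h0, map_zero]⟩
      basis := fun m => (Module.Basis.mk (hind m) (hspan m)).reindex
        { toFun := fun β => ⟨⟨β.1, m, β.2⟩, β.2⟩
          invFun := fun β => ⟨β.1.1, β.2⟩
          left_inv := fun _ => rfl
          right_inv := fun _ => rfl }
      map_of_mem := by
        intro i j h β hi hj
        simp only [Module.Basis.reindex_apply, Module.Basis.mk_apply, hM.map_arrow]
        exact hM.map_map _ _ _
      map_of_notMem := by
        intro i j h β hi hj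
        simp only [Module.Basis.reindex_apply, Module.Basis.mk_apply, hM.map_arrow]
        change f _ (f _ _) = 0
        rw [hM.map_map]
        by_contra h0
        exact hj ⟨_, h0⟩ }

end Existence

/-! ### Multiplicities of bars from ranks of transition maps. -/

section Uniqueness

variable {F : Type v} [Field F] {ι : Type u} [LinearOrder ι]
  {M : ZigzagModule.{u, v, w} F ι} {f : ∀ {a b : ι}, a ≤ b → M.space a →ₗ[F] M.space b}
  {B : Type}

namespace IntervalDecomposition

theorem map_le (hM : IsPersistence M f) (I : IntervalDecomposition M B) {a b : ι} (h : a ≤ b)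
    (β : B) (ha : a ∈ I.bar β) :
    (∀ hb : b ∈ I.bar β, f h (I.basis a ⟨β, ha⟩) = I.basis b ⟨β, hb⟩) ∧
      (b ∉ I.bar β → f h (I.basis a ⟨β, ha⟩) = 0) := by
  have := hM.wellFoundedLT
  induction b using WellFoundedLT.induction with
  | ind b ih =>
    rcases h.eq_or_lt with rfl | hlt
    · exact ⟨fun hb => hM.map_refl _ _, fun hb => absurd ha hb⟩
    · obtain ⟨c, hac, hcb⟩ := hM.exists_covBy hlt
      have harr := hM.arrow_iff.2 hcb
      obtain ⟨h1, h2⟩ := ih c hcb.lt hac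
      rw [← hM.map_map hac hcb.le, ← hM.map_arrow harr]
      refine ⟨fun hb => ?_, fun hb => ?_⟩
      · have hc : c ∈ I.bar β := (I.bar_ordConnected β).out ha hb ⟨hac, hcb.le⟩
        rw [h1 hc, I.map_of_mem harr β hc hb]
      · by_cases hc : c ∈ I.bar β
        · rw [h1 hc, I.map_of_notMem harr β hc hb]
        · rw [h2 hc, map_zero]

theorem finite_bars (hM : IsPersistence M f) (I : IntervalDecomposition M B) (a : ι) :
    {β | a ∈ I.bar β}.Finite := by
  have := hM.finite_space a
  exact Module.Finite.finite_basis (I.basis a)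

/-- The number of bars that contain `a` and `b` is the rank of the transition map. -/
theorem encard_bars (hM : IsPersistence M f) (I : IntervalDecomposition M B) {a b : ι}
    (h : a ≤ b) : {β | a ∈ I.bar β ∧ b ∈ I.bar β}.encard =
      (Module.finrank F (LinearMap.range (f h)) : ℕ∞) := by
  classical
  have hfin : Finite {β | a ∈ I.bar β ∧ b ∈ I.bar β} :=
    (I.finite_bars hM a).subset fun β hβ => hβ.1
  have := Fintype.ofFinite {β | a ∈ I.bar β ∧ b ∈ I.bar β}
  let v : {β | a ∈ I.bar β ∧ b ∈ I.bar β} → M.space b := fun β => I.basis b ⟨β.1, β.2.2⟩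
  have hv : LinearIndependent F v := (I.basis b).linearIndependent.comp
    (fun β : {β | a ∈ I.bar β ∧ b ∈ I.bar β} => (⟨β.1, β.2.2⟩ : {β // b ∈ I.bar β}))
    fun β β' hβ => Subtype.ext (Subtype.ext_iff.1 hβ :)
  have hrange : LinearMap.range (f h) = Submodule.span F (Set.range v) := by
    refine le_antisymm ?_ (Submodule.span_le.2 ?_)
    · rw [LinearMap.range_eq_map, ← (I.basis a).span_eq, Submodule.map_span_le]
      rintro _ ⟨⟨β, ha⟩, rfl⟩
      by_cases hb : b ∈ I.bar β
      · rw [(I.map_le hM h β ha).1 hb]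
        exact Submodule.subset_span ⟨⟨β, ha, hb⟩, rfl⟩
      · rw [(I.map_le hM h β ha).2 hb]
        exact Submodule.zero_mem _
    · rintro _ ⟨β, rfl⟩
      exact ⟨I.basis a ⟨β.1, β.2.1⟩, (I.map_le hM h β.1 β.2.1).1 β.2.2⟩
  rw [hrange, finrank_span_eq_card hv, Set.encard, ENat.card_eq_coe_fintype_card]

/-- The bars that start at `a` and contain `c`. -/
def barsFrom (I : IntervalDecomposition M B) (a c : ι) : Set B :=
  {β | IsLeast (I.bar β) a ∧ c ∈ I.bar β}

theorem finite_barsFrom (hM : IsPersistence M f) (I : IntervalDecomposition M B) (a c : ι) :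
    (I.barsFrom a c).Finite :=
  (I.finite_bars hM a).subset fun _ hβ => hβ.1.1

/-- A bar through `a` and `c` either contains the predecessor `p` of `a` or starts at `a`. -/
theorem encard_barsFrom_add (I : IntervalDecomposition M B) {p a c : ι} (hp : p ⋖ a)
    (hac : a ≤ c) : (I.barsFrom a c).encard + {β | p ∈ I.bar β ∧ c ∈ I.bar β}.encard =
      {β | a ∈ I.bar β ∧ c ∈ I.bar β}.encard := by
  rw [← Set.encard_union_eq]
  · congr 1
    ext β
    constructor
    · rintro (h | h)
      · exact ⟨h.1.1, h.2⟩
      · exact ⟨(I.bar_ordConnected β).out h.1 h.2 ⟨hp.le, hac⟩, h.2⟩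
    · rintro ⟨ha, hc⟩
      by_cases h : p ∈ I.bar β
      · exact Or.inr ⟨h, hc⟩
      · refine Or.inl ⟨⟨ha, fun x hx => ?_⟩, hc⟩
        by_contra hxa
        rw [not_le] at hxa
        exact h ((I.bar_ordConnected β).out hx ha ⟨hp.le_of_lt hxa, hp.le⟩)
  · rw [Set.disjoint_left]
    intro β h h'
    exact absurd (h.1.2 h'.1) (not_le_of_gt hp.lt)

theorem barsFrom_eq_of_isMin (I : IntervalDecomposition M B) {a c : ι} (ha : ∀ x, a ≤ x) :
    I.barsFrom a c = {β | a ∈ I.bar β ∧ c ∈ I.bar β} :=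
  Set.ext fun _ => ⟨fun h => ⟨h.1.1, h.2⟩, fun h => ⟨⟨h.1, fun x _ => ha x⟩, h.2⟩⟩

variable {B' : Type}

/-- The count is `rank (a → c) - rank (p → c)` with `p` the predecessor of `a`, or `rank (a → c)` if
`a` is minimal. Finiteness of the ranks permits the cancellation in `ℕ∞`. -/
theorem encard_barsFrom_eq (hM : IsPersistence M f) (I : IntervalDecomposition M B)
    (J : IntervalDecomposition M B') {a c : ι} (hac : a ≤ c) :
    (I.barsFrom a c).encard = (J.barsFrom a c).encard := by
  by_cases h : ∃ x, x < a
  · obtain ⟨x, hx⟩ := h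
    obtain ⟨p, -, hp⟩ := hM.exists_covBy hx
    have h1 := I.encard_barsFrom_add hp hac
    have h2 := J.encard_barsFrom_add hp hac
    rw [I.encard_bars hM hac, I.encard_bars hM (hp.le.trans hac)] at h1
    rw [J.encard_bars hM hac, J.encard_bars hM (hp.le.trans hac), ← h1] at h2
    exact (ENat.add_left_injective_of_ne_top (ENat.natCast_ne_top _) h2).symm
  · push Not at h
    rw [I.barsFrom_eq_of_isMin h, J.barsFrom_eq_of_isMin h, I.encard_bars hM hac,
      J.encard_bars hM hac]

theorem encard_barsFrom_diff (I : IntervalDecomposition M B) {a c d : ι} (hac : a ≤ c)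
    (hcd : c ≤ d) :
    (I.barsFrom a c \ I.barsFrom a d).encard + (I.barsFrom a d).encard =
      (I.barsFrom a c).encard :=
  Set.encard_sdiff_add_encard_of_subset fun β hβ =>
    ⟨hβ.1, (I.bar_ordConnected β).out hβ.1.1 hβ.2 ⟨hac, hcd⟩⟩

theorem encard_barsFrom_diff_eq (hM : IsPersistence M f) (I : IntervalDecomposition M B)
    (J : IntervalDecomposition M B') {a c d : ι} (hac : a ≤ c) (hcd : c ≤ d) :
    (I.barsFrom a c \ I.barsFrom a d).encard = (J.barsFrom a c \ J.barsFrom a d).encard := by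
  have h1 := I.encard_barsFrom_diff hac hcd
  have h2 := J.encard_barsFrom_diff hac hcd
  rw [I.encard_barsFrom_eq hM J hac, I.encard_barsFrom_eq hM J (hac.trans hcd), ← h2] at h1
  exact ENat.add_left_injective_of_ne_top (J.finite_barsFrom hM a d).encard_lt_top.ne h1

/-- Death at `d` means that the bar contains the predecessor of `d` but not `d`; this makes deaths
countable through `barsFrom`. -/
theorem isLeast_death_iff (hM : IsPersistence M f) (I : IntervalDecomposition M B) {a d : ι}
    {β : B} (h : IsLeast (I.bar β) a) : IsLeast {j | ∀ i ∈ I.bar β, i < j} d ↔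
      ∃ c, a ≤ c ∧ c ⋖ d ∧ c ∈ I.bar β ∧ d ∉ I.bar β := by
  constructor
  · rintro ⟨hd, hmin⟩
    obtain ⟨c, hac, hcd⟩ := hM.exists_covBy (hd a h.1)
    refine ⟨c, hac, hcd, ?_, fun hd' => (hd d hd').false⟩
    by_contra hc
    refine absurd (hmin (fun i hi => ?_ : c ∈ {j | ∀ i ∈ I.bar β, i < j})) (not_le_of_gt hcd.lt)
    exact lt_of_le_of_ne (hcd.le_of_lt (hd i hi)) fun h => hc (h ▸ hi)
  · rintro ⟨c, -, hcd, hc, hd⟩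
    refine ⟨fun i hi => ?_, fun x hx => ?_⟩
    · by_contra hi'
      exact hd ((I.bar_ordConnected β).out hc hi ⟨hcd.le, not_lt.1 hi'⟩)
    · by_contra hxd
      exact absurd (hx c hc) (not_lt_of_ge (hcd.le_of_lt (not_le.1 hxd)))

/-- The bars that start at `a` and have no index after them. -/
def barsForever (I : IntervalDecomposition M B) (a : ι) : Set B :=
  {β | IsLeast (I.bar β) a ∧ ¬ ∃ j, ∀ i ∈ I.bar β, i < j}

/-- Only finitely many bars start at `a`, so one index `c` bounds all those that die; beyond it,
being alive means living forever. -/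
theorem exists_barsForever_eq (hM : IsPersistence M f) (I : IntervalDecomposition M B) (a : ι) :
    ∃ c, a ≤ c ∧ ∀ c', c ≤ c' → I.barsForever a = I.barsFrom a c' := by
  have hmem : ∀ β ∈ I.barsForever a, ∀ c, a ≤ c → c ∈ I.bar β := by
    rintro β ⟨ha, hβ⟩ c hac
    push Not at hβ
    obtain ⟨i, hi, hci⟩ := hβ c
    exact (I.bar_ordConnected β).out ha.1 hi ⟨hac, hci⟩
  have hex : ∀ β ∈ I.barsFrom a a \ I.barsForever a, ∃ c, ∀ i ∈ I.bar β, i < c := by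
    rintro β ⟨hβ, hβ'⟩
    by_contra h
    exact hβ' ⟨hβ.1, h⟩
  have : Nonempty ι := ⟨a⟩
  choose! g hg using hex
  have hfin : (insert a (g '' (I.barsFrom a a \ I.barsForever a))).Finite :=
    (((I.finite_barsFrom hM a a).sdiff).image g).insert a
  obtain ⟨c, hc, hmax⟩ := Set.exists_max_image _ id hfin (Set.insert_nonempty _ _)
  have hac : a ≤ c := hmax a (Set.mem_insert _ _)
  refine ⟨c, hac, fun c' hcc' => Set.ext fun β => ⟨fun h => ?_, fun h => ?_⟩⟩
  · exact ⟨h.1, hmem β h c' (hac.trans hcc')⟩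
  · by_contra hβ
    have hβ' : β ∈ I.barsFrom a a \ I.barsForever a := ⟨⟨h.1, h.1.1⟩, hβ⟩
    have h1 : g β ≤ c := hmax (g β) (Set.mem_insert_of_mem _ ⟨β, hβ', rfl⟩)
    exact absurd (hg β hβ' c' h.2) (not_lt_of_ge (h1.trans hcc'))

theorem encard_barsForever_eq (hM : IsPersistence M f) (I : IntervalDecomposition M B)
    (J : IntervalDecomposition M B') (a : ι) :
    (I.barsForever a).encard = (J.barsForever a).encard := by
  obtain ⟨c, hac, hc⟩ := I.exists_barsForever_eq hM a
  obtain ⟨c', hac', hc'⟩ := J.exists_barsForever_eq hM a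
  rw [hc (max c c') (le_max_left _ _), hc' (max c c') (le_max_right _ _)]
  exact I.encard_barsFrom_eq hM J (hac.trans (le_max_left _ _))

theorem setOf_birth_death_top (I : IntervalDecomposition M B) {scale : ι → ℝ}
    (hs : Function.Injective scale) (a : ι) :
    {β | IsBirth scale (I.bar β) (scale a) ∧ IsDeath scale (I.bar β) ⊤} = I.barsForever a := by
  ext β
  constructor
  · rintro ⟨⟨i, hi, hia⟩, ⟨j, -, hj⟩ | ⟨h, -⟩⟩
    · exact absurd hj WithTop.top_ne_coe
    · obtain rfl := hs (WithTop.coe_injective hia)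
      exact ⟨hi, h⟩
  · rintro ⟨ha, h⟩
    exact ⟨⟨a, ha, rfl⟩, Or.inr ⟨h, rfl⟩⟩

theorem setOf_birth_death_coe (hM : IsPersistence M f) (I : IntervalDecomposition M B)
    {scale : ι → ℝ} (hs : Function.Injective scale) {a c d : ι} (hac : a ≤ c) (hcd : c ⋖ d) :
    {β | IsBirth scale (I.bar β) (scale a) ∧ IsDeath scale (I.bar β) (scale d)} =
      I.barsFrom a c \ I.barsFrom a d := by
  ext β
  constructor
  · rintro ⟨⟨i, hi, hia⟩, ⟨j, hj, hjd⟩ | ⟨-, h⟩⟩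
    · obtain rfl := hs (WithTop.coe_injective hia)
      obtain rfl := hs (WithTop.coe_injective hjd)
      obtain ⟨c', -, hc', hcβ, hdβ⟩ := (I.isLeast_death_iff hM hi).1 hj
      obtain rfl := hc'.unique_left hcd
      exact ⟨⟨hi, hcβ⟩, fun h => hdβ h.2⟩
    · exact absurd h WithTop.coe_ne_top
  · rintro ⟨⟨ha, hc⟩, hd⟩
    exact ⟨⟨a, ha, rfl⟩, Or.inl ⟨d, (I.isLeast_death_iff hM ha).2
      ⟨c, hac, hcd, hc, fun h => hd ⟨ha, h⟩⟩, rfl⟩⟩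

theorem encard_birth_death_eq (hM : IsPersistence M f) (I : IntervalDecomposition M B)
    (J : IntervalDecomposition M B') {scale : ι → ℝ} (hs : Function.Injective scale)
    (x y : WithTop ℝ) :
    {β | IsBirth scale (I.bar β) x ∧ IsDeath scale (I.bar β) y}.encard =
      {β | IsBirth scale (J.bar β) x ∧ IsDeath scale (J.bar β) y}.encard := by
  by_cases hx : ∃ a, x = scale a
  · obtain ⟨a, rfl⟩ := hx
    rcases eq_or_ne y ⊤ with rfl | hy
    · rw [I.setOf_birth_death_top hs, J.setOf_birth_death_top hs, I.encard_barsForever_eq hM J]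
    · by_cases hd : ∃ d, a < d ∧ y = scale d
      · obtain ⟨d, had, rfl⟩ := hd
        obtain ⟨c, hac, hcd⟩ := hM.exists_covBy had
        rw [I.setOf_birth_death_coe hM hs hac hcd, J.setOf_birth_death_coe hM hs hac hcd,
          I.encard_barsFrom_diff_eq hM J hac hcd.le]
      · have hempty : ∀ {C : Type} (K : IntervalDecomposition M C),
            {β | IsBirth scale (K.bar β) (scale a) ∧ IsDeath scale (K.bar β) y} = ∅ := by
          intro C K
          refine Set.eq_empty_of_forall_notMem fun β => ?_
          rintro ⟨⟨i, hi, hia⟩, ⟨j, hj, hjy⟩ | ⟨-, h⟩⟩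
          · obtain rfl := hs (WithTop.coe_injective hia)
            exact hd ⟨j, hj.1 _ hi.1, hjy⟩
          · exact hy h
        rw [hempty I, hempty J, Set.encard_empty, Set.encard_empty]
  · have hempty : ∀ {C : Type} (K : IntervalDecomposition M C),
        {β | IsBirth scale (K.bar β) x ∧ IsDeath scale (K.bar β) y} = ∅ := by
      intro C K
      refine Set.eq_empty_of_forall_notMem fun β => ?_
      rintro ⟨⟨i, -, hi⟩, -⟩
      exact hx ⟨i, hi⟩
    rw [hempty I, hempty J, Set.encard_empty, Set.encard_empty]

/-- The persistence diagram does not depend on the interval decomposition. -/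
theorem diagram_eq (hM : IsPersistence M f) (I : IntervalDecomposition M B)
    (J : IntervalDecomposition M B') {scale : ι → ℝ} (hs : Function.Injective scale) :
    I.diagram scale = J.diagram scale := by
  funext z
  unfold diagram
  split_ifs
  · rfl
  · exact I.encard_birth_death_eq hM J hs z.1 z.2

end IntervalDecomposition

end Uniqueness

/-! ### Comparison of decompositions of different modules. -/

section Transfer

variable {F : Type v} [Field F] {ι : Type u} [LinearOrder ι] {B : Type}

theorem IntervalDecomposition.diagram_congr {κ : Type u} [LinearOrder κ]
    {M : ZigzagModule.{u, v, w} F ι} {N : ZigzagModule.{u, v, w'} F κ}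
    (I : IntervalDecomposition M B) (J : IntervalDecomposition N B) {s : ι → ℝ} {s' : κ → ℝ}
    (h : ∀ β x, IsBirth s (I.bar β) x ↔ IsBirth s' (J.bar β) x)
    (h' : ∀ β y, IsDeath s (I.bar β) y ↔ IsDeath s' (J.bar β) y) :
    I.diagram s = J.diagram s' := by
  funext z
  unfold diagram
  split_ifs
  · rfl
  · exact ENat.card_congr (Equiv.subtypeEquivRight fun β => and_congr (h β _) (h' β _))

/-- A bijective arrow does not change the set of bars. -/
theorem IntervalDecomposition.mem_bar_iff_of_bijective {M : ZigzagModule.{u, v, w} F ι}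
    (I : IntervalDecomposition M B) {i j : ι} (h : M.arrow i j)
    (hbij : Function.Bijective (M.map h)) (β : B) : i ∈ I.bar β ↔ j ∈ I.bar β := by
  constructor
  · intro hi
    by_contra hj
    have h0 := I.map_of_notMem h β hi hj
    rw [← map_zero (M.map h)] at h0
    exact (I.basis i).ne_zero _ (hbij.1 h0)
  · intro hj
    by_contra hi
    -- If no basis vector of `β` exists at `i`, the `β`-coordinate vanishes on the image of the
    -- arrow, against surjectivity.
    have h0 : ∀ x, (I.basis j).coord ⟨β, hj⟩ (M.map h x) = 0 := by
      intro x
      have : (I.basis j).coord ⟨β, hj⟩ ∘ₗ M.map h = 0 := by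
        refine (I.basis i).ext ?_
        rintro ⟨γ, hγ⟩
        rw [LinearMap.comp_apply, LinearMap.zero_apply]
        by_cases hγj : γ ∈ {γ | j ∈ I.bar γ}
        · rw [I.map_of_mem h γ hγ hγj, Module.Basis.coord_apply, Module.Basis.repr_self,
            Finsupp.single_eq_of_ne]
          intro heq
          obtain rfl : β = γ := congrArg Subtype.val heq
          exact hi hγ
        · rw [I.map_of_notMem h γ hγ hγj, map_zero]
      exact LinearMap.congr_fun this x
    obtain ⟨x, hx⟩ := hbij.2 (I.basis j ⟨β, hj⟩)
    have h1 := h0 x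
    rw [hx, Module.Basis.coord_apply, Module.Basis.repr_self, Finsupp.single_eq_same] at h1
    exact one_ne_zero h1

end Transfer

/-! ### Intervals in the doubled index set. -/

section Lex

variable {A : Set ℝ}

/-- The indices of the two complexes at a scale of `s`. -/
def doubled (s : Set A) : Set (A ×ₗ Bool) := {i | (ofLex i).1 ∈ s}

theorem isLeast_doubled (s : Set A) (i : A ×ₗ Bool) :
    IsLeast (doubled s) i ↔ IsLeast s (ofLex i).1 ∧ (ofLex i).2 = false := by
  obtain ⟨⟨a, c⟩, rfl⟩ := toLex.surjective i
  simp only [ofLex_toLex]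
  constructor
  · rintro ⟨ha, hmin⟩
    refine ⟨⟨ha, fun b hb => ?_⟩, ?_⟩
    · exact (Prod.Lex.monotone_fst _ _ (hmin (show toLex (b, false) ∈ doubled s from hb)) :)
    · have := hmin (show toLex (a, false) ∈ doubled s from ha)
      rw [Prod.Lex.toLex_le_toLex] at this
      exact le_bot_iff.1 (this.resolve_left (lt_irrefl a)).2
  · rintro ⟨⟨ha, hmin⟩, rfl⟩
    refine ⟨ha, fun j hj => ?_⟩
    obtain ⟨⟨b, d⟩, rfl⟩ := toLex.surjective j
    rw [Prod.Lex.toLex_le_toLex]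
    rcases (hmin hj).lt_or_eq with h | h
    · exact Or.inl h
    · exact Or.inr ⟨h, Bool.false_le d⟩

/-- The two indices at a scale are never separated, so taking what comes after commutes with
doubling; hence death scales are preserved. -/
theorem setOf_after_doubled {s : Set A} : {j | ∀ i ∈ doubled s, i < j} =
    doubled {b | ∀ a ∈ s, a < b} := by
  ext j
  obtain ⟨⟨b, d⟩, rfl⟩ := toLex.surjective j
  constructor
  · intro h a ha
    have := h (toLex (a, true)) ha
    rw [Prod.Lex.toLex_lt_toLex] at this
    rcases this with h | ⟨-, h⟩
    · exact h
    · exact absurd h (by simp [Bool.lt_iff])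
  · intro h i hi
    obtain ⟨⟨a, c⟩, rfl⟩ := toLex.surjective i
    rw [Prod.Lex.toLex_lt_toLex]
    exact Or.inl (h a hi)

theorem exists_isLeast_doubled (s : Set A) (x : WithTop ℝ) :
    (∃ i, IsLeast (doubled s) i ∧ x = (((ofLex i).1 : ℝ) : WithTop ℝ)) ↔
      ∃ a, IsLeast s a ∧ x = ((a : ℝ) : WithTop ℝ) := by
  constructor
  · rintro ⟨i, hi, hx⟩
    exact ⟨_, ((isLeast_doubled s i).1 hi).1, hx⟩
  · rintro ⟨a, ha, hx⟩
    exact ⟨toLex (a, false), (isLeast_doubled s _).2 ⟨ha, rfl⟩, hx⟩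

theorem isBirth_doubled (s : Set A) (x : WithTop ℝ) :
    IsBirth (fun i : A ×ₗ Bool => ((ofLex i).1 : ℝ)) (doubled s) x ↔
      IsBirth (fun a : A => (a : ℝ)) s x :=
  exists_isLeast_doubled s x

theorem isDeath_doubled (s : Set A) (y : WithTop ℝ) :
    IsDeath (fun i : A ×ₗ Bool => ((ofLex i).1 : ℝ)) (doubled s) y ↔
      IsDeath (fun a : A => (a : ℝ)) s y := by
  have hex : (∃ j, ∀ i ∈ doubled s, i < j) ↔ ∃ b, ∀ a ∈ s, a < b := by
    change ({j | ∀ i ∈ doubled s, i < j} : Set _).Nonempty ↔ _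
    rw [setOf_after_doubled]
    exact ⟨fun ⟨i, hi⟩ => ⟨_, hi⟩, fun ⟨b, hb⟩ => ⟨toLex (b, false), hb⟩⟩
  unfold IsDeath
  rw [setOf_after_doubled, exists_isLeast_doubled, hex]

theorem ordConnected_doubled {s : Set A} (hs : s.OrdConnected) : (doubled s).OrdConnected :=
  ⟨fun _ hx _ hy _ hz => hs.out hx hy
    ⟨Prod.Lex.monotone_fst _ _ hz.1, Prod.Lex.monotone_fst _ _ hz.2⟩⟩

end Lex

/-! ### Decompositions of a persistence module and of its doubling. -/

section Doubling

variable {F : Type v} [Field F] {A : Set ℝ} {B : Type}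
  {N : ZigzagModule.{0, v, w'} F (A ×ₗ Bool)} {M : ZigzagModule.{0, v, w} F A}
  {f : ∀ {a b : A}, a ≤ b → M.space a →ₗ[F] M.space b}
  {e : ∀ i : A ×ₗ Bool, N.space i ≃ₗ[F] M.space (ofLex i).1}

/-- The zigzag module `N` is obtained from the persistence module `M` by replacing each space by
two isomorphic ones. -/
structure IsDoubling (N : ZigzagModule.{0, v, w'} F (A ×ₗ Bool)) (M : ZigzagModule.{0, v, w} F A)
    (f : ∀ {a b : A}, a ≤ b → M.space a →ₗ[F] M.space b)
    (e : ∀ i : A ×ₗ Bool, N.space i ≃ₗ[F] M.space (ofLex i).1) : Prop where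
  isPersistence : IsPersistence M f
  arrow_iff : ∀ {i j}, N.arrow i j ↔ zigzagArrow A i j
  map_equiv : ∀ {i j} (h : N.arrow i j) (h' : (ofLex i).1 ≤ (ofLex j).1) (x : N.space i),
    e j (N.map h x) = f h' (e i x)

namespace IsDoubling

theorem le_of_arrow (hN : IsDoubling N M f e) {i j : A ×ₗ Bool} (h : N.arrow i j) :
    (ofLex i).1 ≤ (ofLex j).1 :=
  (hN.arrow_iff.1 h).2.2.elim (fun h => h.ge) fun h => h.le

theorem arrow_back (hN : IsDoubling N M f e) (a : A) :
    N.arrow (toLex (a, true)) (toLex (a, false)) :=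
  hN.arrow_iff.2 ⟨rfl, rfl, Or.inl rfl⟩

theorem arrow_forward (hN : IsDoubling N M f e) {a b : A} (h : a ⋖ b) :
    N.arrow (toLex (a, true)) (toLex (b, false)) :=
  hN.arrow_iff.2 ⟨rfl, rfl, Or.inr h⟩

theorem map_symm (hN : IsDoubling N M f e) {i j : A ×ₗ Bool} (h : N.arrow i j)
    (x : M.space (ofLex i).1) :
    N.map h ((e i).symm x) = (e j).symm (f (hN.le_of_arrow h) x) := by
  rw [LinearEquiv.eq_symm_apply, hN.map_equiv h (hN.le_of_arrow h), LinearEquiv.apply_symm_apply]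

theorem equiv_map_back (hN : IsDoubling N M f e) (a : A) (x : N.space (toLex (a, true))) :
    e (toLex (a, false)) (N.map (hN.arrow_back a) x) = e (toLex (a, true)) x :=
  (hN.map_equiv (hN.arrow_back a) le_rfl x).trans (hN.isPersistence.map_refl a _)

theorem bijective_map_back (hN : IsDoubling N M f e) (a : A) :
    Function.Bijective (N.map (hN.arrow_back a)) := by
  refine (Function.Bijective.of_comp_iff' (e (toLex (a, false))).bijective _).1 ?_
  rw [show ⇑(e (toLex (a, false))) ∘ ⇑(N.map (hN.arrow_back a)) = e (toLex (a, true)) from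
    funext (hN.equiv_map_back a)]
  exact (e (toLex (a, true))).bijective

/-- The interval decomposition of a doubling of a decomposed persistence module. -/
def double (hN : IsDoubling N M f e) (I : IntervalDecomposition M B) :
    IntervalDecomposition N B where
  bar β := doubled (I.bar β)
  bar_nonempty β :=
    let ⟨a, ha⟩ := I.bar_nonempty β
    ⟨toLex (a, false), ha⟩
  bar_ordConnected β := ordConnected_doubled (I.bar_ordConnected β)
  basis i := (I.basis (ofLex i).1).map (e i).symm
  map_of_mem {i j} h β hi hj :=
    (hN.map_symm h (I.basis (ofLex i).1 ⟨β, hi⟩)).trans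
      (congrArg (e j).symm ((I.map_le hN.isPersistence (hN.le_of_arrow h) β hi).1 hj))
  map_of_notMem {i j} h β hi hj :=
    (hN.map_symm h (I.basis (ofLex i).1 ⟨β, hi⟩)).trans
      ((congrArg (e j).symm ((I.map_le hN.isPersistence (hN.le_of_arrow h) β hi).2 hj)).trans
        (map_zero _))

theorem mem_bar_iff (hN : IsDoubling N M f e) (J : IntervalDecomposition N B) (β : B) (a : A) :
    toLex (a, true) ∈ J.bar β ↔ toLex (a, false) ∈ J.bar β :=
  J.mem_bar_iff_of_bijective (hN.arrow_back a) (hN.bijective_map_back a) β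

/-- Backward arrows are isomorphisms, so a bar contains both indices at a scale or neither. -/
theorem bar_eq_doubled (hN : IsDoubling N M f e) (J : IntervalDecomposition N B) (β : B) :
    J.bar β = doubled {a | toLex (a, true) ∈ J.bar β} := by
  ext i
  obtain ⟨⟨a, c⟩, rfl⟩ := toLex.surjective i
  cases c with
  | false => exact (hN.mem_bar_iff J β a).symm
  | true => exact Iff.rfl

theorem map_forward (hN : IsDoubling N M f e) {a b : A} (h : M.arrow a b)
    (x : N.space (toLex (a, true))) :
    M.map h (e (toLex (a, true)) x) = e (toLex (b, false))
      (N.map (hN.arrow_forward (hN.isPersistence.arrow_iff.1 h)) x) := by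
  rw [hN.isPersistence.map_arrow h]
  exact (hN.map_equiv (hN.arrow_forward (hN.isPersistence.arrow_iff.1 h)) _ x).symm

/-- The interval decomposition of a persistence module whose doubling is decomposed. -/
def undouble (hN : IsDoubling N M f e) (J : IntervalDecomposition N B) :
    IntervalDecomposition M B where
  bar β := {a | toLex (a, true) ∈ J.bar β}
  bar_nonempty β := by
    obtain ⟨i, hi⟩ := J.bar_nonempty β
    rw [hN.bar_eq_doubled J β] at hi
    exact ⟨_, hi⟩
  bar_ordConnected β := ⟨fun x hx y hy z hz => (J.bar_ordConnected β).out hx hy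
    ⟨Prod.Lex.toLex_le_toLex.2 (hz.1.lt_or_eq.imp id fun h => ⟨h, le_rfl⟩),
      Prod.Lex.toLex_le_toLex.2 (hz.2.lt_or_eq.imp id fun h => ⟨h, le_rfl⟩)⟩⟩
  basis a := (J.basis (toLex (a, true))).map (e (toLex (a, true)))
  map_of_mem {a b} h β ha hb := by
    refine (hN.map_forward h (J.basis _ ⟨β, ha⟩)).trans ?_
    -- The forward arrow ends at the index `(b, false)`, while the basis at `b` is taken from `(b,
    -- true)`; the backward arrow identifies the two basis vectors.
    rw [J.map_of_mem _ β ha ((hN.mem_bar_iff J β b).1 hb),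
      ← J.map_of_mem (hN.arrow_back b) β hb ((hN.mem_bar_iff J β b).1 hb)]
    exact hN.equiv_map_back b _
  map_of_notMem {a b} h β ha hb := by
    refine (hN.map_forward h (J.basis _ ⟨β, ha⟩)).trans ?_
    rw [J.map_of_notMem _ β ha fun hb' => hb ((hN.mem_bar_iff J β b).2 hb'), map_zero]
    rfl

/-- A persistence module and its doubling have the same persistence diagrams. -/
theorem isPersistenceDiagram_iff (hN : IsDoubling N M f e) {D : WithTop ℝ × WithTop ℝ → ℕ∞} :
    IsPersistenceDiagram N (fun i : A ×ₗ Bool => ((ofLex i).1 : ℝ)) D ↔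
      IsPersistenceDiagram M (fun a : A => (a : ℝ)) D := by
  constructor
  · rintro ⟨B, J, rfl⟩
    refine ⟨B, hN.undouble J, J.diagram_congr _ (fun β x => ?_) fun β y => ?_⟩
    · rw [hN.bar_eq_doubled J β]
      exact isBirth_doubled _ x
    · rw [hN.bar_eq_doubled J β]
      exact isDeath_doubled _ y
  · rintro ⟨B, I, rfl⟩
    exact ⟨B, hN.double I, I.diagram_congr _ (fun β x => (isBirth_doubled _ x).symm)
      fun β y => (isDeath_doubled _ y).symm⟩

end IsDoubling

end Doubling

/-! ### The zigzag homology as a doubling of the homology of the union. -/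

section SparseModules

variable {P : Type u} [MetricSpace P] {Kp : ℝ} {ε : ℝ} {A : Set ℝ}

theorem isPersistence_sparseRips [Finite P] {t : P → WithTop ℝ} (hA : IsScaleSet ε t A)
    (F : Type v) [Field F] (k : ℕ) : IsPersistence ((sparseRips ε t A).homology F k)
      (fun {_ _} h => homologyMap F (unionComplex_mono t h) k) where
  finite_Iic a := by
    have h := (hA.finite_below a a.2).preimage (f := fun b : A => (b : ℝ))
      Subtype.val_injective.injOn
    exact h.subset fun b hb => ⟨b.2, hb⟩
  finite_space _ := finite_homology F k
  map_refl _ x := homologyMap_refl F _ k x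
  map_map _ _ x := homologyMap_homologyMap F _ _ k x
  arrow_iff := Iff.rfl
  map_arrow _ := rfl

theorem zigzagComplex_le_unionComplex (h0 : 0 < ε) (h1 : ε ≤ 1 / 3) {t : P → WithTop ℝ}
    (hA : IsScaleSet ε t A) (i : A ×ₗ Bool) :
    zigzagComplex ε t A i ≤ unionComplex ε t A (ofLex i).1 := by
  unfold zigzagComplex
  split_ifs
  · exact (openComplex_le_closedComplex h0 h1 t (hA.nonneg _ (ofLex i).1.2)).trans
      (closedComplex_le_unionComplex t _)
  · exact closedComplex_le_unionComplex t _

variable (T : NetTree.{u, w} P Kp) (h0 : 0 < ε) (h1 : ε ≤ 1 / 3)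
  (hA : IsScaleSet ε (T.deletionTime ε) A) (F : Type v) [Field F] (k : ℕ)

theorem bijective_homologyMap_zigzagComplex (i : A ×ₗ Bool) :
    Function.Bijective (homologyMap F (zigzagComplex_le_unionComplex h0 h1 hA i) k) := by
  obtain ⟨⟨a, c⟩, rfl⟩ := toLex.surjective i
  cases c with
  | false => exact bijective_homologyMap_closedComplex T h0 h1 hA F k a _
  | true => exact bijective_homologyMap_openComplex T h0 h1 hA F k a _

/-- The homology of each complex of the zigzag filtration is that of the union. -/
def zigzagEquiv (i : A ×ₗ Bool) : ((zigzagRips h0 h1 hA).homology F k).space i ≃ₗ[F]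
    ((sparseRips ε (T.deletionTime ε) A).homology F k).space (ofLex i).1 :=
  LinearEquiv.ofBijective _ (bijective_homologyMap_zigzagComplex T h0 h1 hA F k i)

theorem isDoubling_zigzagRips : IsDoubling ((zigzagRips h0 h1 hA).homology F k)
    ((sparseRips ε (T.deletionTime ε) A).homology F k)
    (fun {_ _} h => homologyMap F (unionComplex_mono (T.deletionTime ε) h) k)
    (zigzagEquiv T h0 h1 hA F k) where
  isPersistence :=
    have := T.finite_points
    isPersistence_sparseRips hA F k
  arrow_iff := Iff.rfl
  -- Both paths around the square are induced by the single inclusion of the complex at `i` into the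
  -- union at the scale of `j`.
  map_equiv {i j} h h' x :=
    (homologyMap_homologyMap F ((zigzagRips h0 h1 hA).le h)
      (zigzagComplex_le_unionComplex h0 h1 hA j) k x).trans
    (homologyMap_homologyMap F (zigzagComplex_le_unionComplex h0 h1 hA i)
      (unionComplex_mono (T.deletionTime ε) h') k x).symm

end SparseModules

end SparseRips

end

theorem mainTheorem2 {P : Type*} [MetricSpace P] {Kp : ℝ} (hKp : 0 < Kp)
    (T : SparseRips.NetTree P Kp) {ε : ℝ} (h0 : 0 < ε) (h1 : ε ≤ 1 / 3) {A : Set ℝ}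
    (hA : SparseRips.IsScaleSet ε (T.deletionTime ε) A) (F : Type*) [Field F] (k : ℕ) :
    (∀ a : A, Function.Bijective (SparseRips.homologyMap F
      (SparseRips.openComplex_le_closedComplex h0 h1 (T.deletionTime ε) (hA.nonneg a a.2)) k)) ∧
    ∃ D : WithTop ℝ × WithTop ℝ → ℕ∞,
      (∀ D', SparseRips.IsPersistenceDiagram ((SparseRips.zigzagRips h0 h1 hA).homology F k)
        (fun i : A ×ₗ Bool => ((ofLex i).1 : ℝ)) D' ↔ D' = D) ∧
      (∀ D', SparseRips.IsPersistenceDiagram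
        ((SparseRips.sparseRips ε (T.deletionTime ε) A).homology F k)
        (fun a : A => (a : ℝ)) D' ↔ D' = D) := by
  have hN := SparseRips.isDoubling_zigzagRips T h0 h1 hA F k
  refine ⟨SparseRips.bijective_openComplex_closedComplex T h0 h1 hA F k, ?_⟩
  obtain ⟨B, ⟨I⟩⟩ := hN.isPersistence.exists_intervalDecomposition
  -- Uniqueness is proved for `S`, whose scale function is injective. The zigzag has two indices per
  -- scale, so its uniqueness is transferred through the doubling.
  have hS : ∀ D', SparseRips.IsPersistenceDiagram
      ((SparseRips.sparseRips ε (T.deletionTime ε) A).homology F k)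
      (fun a : A => (a : ℝ)) D' ↔ D' = I.diagram (fun a : A => (a : ℝ)) := by
    refine fun D' => ⟨?_, fun h => ⟨B, I, h⟩⟩
    rintro ⟨B', J, rfl⟩
    exact J.diagram_eq hN.isPersistence I Subtype.val_injective
  exact ⟨_, fun D' => hN.isPersistenceDiagram_iff.trans (hS D'), hS⟩
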